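/- Let $r \ge 1$ be an integer and $n = 2r$. For a permutation $\sigma$ of $[n]=\{1,\dots,n\}$ let $\mathbf m_\sigma^r \in \{1,2\}^n$ be the tuple with $\mathbf m_\sigma^r(i) = 1$ if $1 \le \sigma(i) \le r$ and $\mathbf m_\sigma^r(i) = 2$ if $r+1 \le \sigma(i) \le 2r$, and let $\mathcal M_r(\mathbb S_n) = \{\mathbf m_\sigma^r : \sigma \in \mathbb S_n\}$ be the set of binary multipermutations. For permutations put $\mathrm d_\circ(\sigma,\pi) = n - \ell(\sigma,\pi)$, where $\ell(\sigma,\pi)$ is the length of a longest common subsequence of the sequences $(\sigma(1),\dots,\sigma(n))$ and $(\pi(1),\dots,\pi(n))$. For multipermutations $\mathbf m, \mathbf m'$ let $\mathrm d_\circ(\mathbf m,\mathbf m')$ be the minimum of $\mathrm d_\circ(\sigma,\pi)$ over all $\sigma,\pi$ with $\mathbf m_\sigma^r=\mathbf m$ and $\mathbf m_\pi^r = \mathbf m'$, and let $S(\mathbf m,1) = \{\mathbf m' \in \mathcal M_r(\mathbb S_n) : \mathrm d_\circ(\mathbf m,\mathbf m') \le 1\}$ be the Ulam sphere of radius $1$.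 Let $\psi(k) = \lfloor (k-2)^2/4 \rfloor$ for integers $k$, and let $\psi$ of a tuple be the sum of the values of $\psi$ at its entries. For $1 \le c \le n-1$ write $n = c\,q_c + \mathrm{rem}_c$ with $0 \le \mathrm{rem}_c < c$ and set $$\mathbf q_c = \begin{cases} (q_c+1, \underbrace{q_c,\dots,q_c}_{c-2}, q_c-1) & \text{if } q_c \text{ is odd and } \mathrm{rem}_c = 0,\\ (\underbrace{q_c+1,\dots,q_c+1}_{\mathrm{rem}_c}, \underbrace{q_c,\dots,q_c}_{c-\mathrm{rem}_c}) & \text{otherwise.}\end{cases}$$ Then $$\max_{\mathbf m \in \mathcal M_r(\mathbb S_n)} |S(\mathbf m,1)| = 1 + (n-1)^2 - \min_{c \in \{\lfloor \sqrt r\rfloor, \lceil \sqrt r\rceil\}} \bigl( c(r-1) + (n-1)(r-1) + \psi(\mathbf q_c)\bigr).$$ Moreover, the maximum is attained at some $\mathbf m$ whose number of cuts is $\lfloor \sqrt r\rfloor$ or $\lceil \sqrt r\rceil$, where a cut of $\mathbf m$ is a locally maximal alternating substring, that is, a block of consecutive entries in which any two neighbouring entries differ and which cannot be extended by one entry on the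 left or on the right with this property. -/

import Mathlib

/-- The multipermutation `m_σ^r`. With one-based indices, its `i`-th entry is the `j`
with `(j - 1) r + 1 ≤ σ(i) ≤ j r`; in `Fin n` the image is `σ(i) - 1`, so `j = (σ(i) - 1) / r + 1`. -/
def multiperm (r : ℕ) {n : ℕ} (σ : Equiv.Perm (Fin n)) : Fin n → ℕ :=
  fun i => (σ i : ℕ) / r + 1

/-- The set `M_r(S_n)` of all `r`-regular multipermutations of length `n`. -/
def multiperms (n r : ℕ) : Set (Fin n → ℕ) :=
  Set.range (multiperm r)

/-- The length of a longest common subsequence of two tuples of length `n`. The set below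
contains `0` and is bounded by `n`, so the supremum is a maximum. -/
noncomputable def lcsLength {α : Type*} {n : ℕ} (x y : Fin n → α) : ℕ :=
  sSup {k : ℕ | ∃ f g : Fin k → Fin n, StrictMono f ∧ StrictMono g ∧ ∀ l, x (f l) = y (g l)}

/-- The Ulam distance of two permutations (the subtraction never truncates). -/
noncomputable def permUlamDist {n : ℕ} (σ π : Equiv.Perm (Fin n)) : ℕ :=
  n - lcsLength σ π

/-- The `r`-regular Ulam distance of two multipermutations: the minimum of the Ulam distances of
the permutations that represent them. It is used only for members of `multiperms n r`, where the
set below is nonempty. -/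
noncomputable def ulamDist (r : ℕ) {n : ℕ} (x y : Fin n → ℕ) : ℕ :=
  sInf {d : ℕ | ∃ σ π : Equiv.Perm (Fin n),
    multiperm r σ = x ∧ multiperm r π = y ∧ d = permUlamDist σ π}

/-- The `r`-regular multipermutation Ulam sphere of radius `t` centred at `x`
(all multipermutations at distance at most `t`). -/
def ulamSphere (r : ℕ) {n : ℕ} (x : Fin n → ℕ) (t : ℕ) : Set (Fin n → ℕ) :=
  {y | y ∈ multiperms n r ∧ ulamDist r x y ≤ t}

/-- `ψ(k) = ⌊(k - 2)² / 4⌋`; division of integers by `4` rounds down. -/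
def psi (k : ℤ) : ℤ := (k - 2) ^ 2 / 4

/-- `ψ` of a tuple: the sum of the values of `ψ` at its entries. -/
def psiTuple (x : List ℤ) : ℤ := (x.map psi).sum

/-- The tuple `q_c`: a partition of `n` (even) into `c` parts that are as equal as possible
subject to having an even part. In the first case `c ≥ 2` when `n` is even and `1 ≤ c < n`. -/
def cutLengths (n c : ℕ) : List ℤ :=
  if Odd (n / c) ∧ n % c = 0 then
    ((n / c : ℕ) + 1 : ℤ) :: (List.replicate (c - 2) ((n / c : ℕ) : ℤ) ++ [((n / c : ℕ) - 1 : ℤ)])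
  else
    List.replicate (n % c) ((n / c : ℕ) + 1 : ℤ) ++ List.replicate (c - n % c) ((n / c : ℕ) : ℤ)

/-- The substring `m[a, b]` is alternating, i.e. of the form `u, v, u, v, …` with `u ≠ v`;
one entry alone is alternating. -/
def IsAlternating {n : ℕ} (m : Fin n → ℕ) (a b : Fin n) : Prop :=
  (∀ i j : Fin n, a ≤ i → j ≤ b → (j : ℕ) = i + 1 → m i ≠ m j) ∧
  (∀ i j : Fin n, a ≤ i → j ≤ b → (j : ℕ) = i + 2 → m i = m j)

/-- The substring `m[a, b]` is a cut: an alternating substring of locally maximal length. -/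
def IsCut {n : ℕ} (m : Fin n → ℕ) (a b : Fin n) : Prop :=
  a ≤ b ∧ IsAlternating m a b ∧
  (∀ a' : Fin n, (a : ℕ) = a' + 1 → ¬ IsAlternating m a' b) ∧
  (∀ b' : Fin n, (b' : ℕ) = b + 1 → ¬ IsAlternating m a b')

/-- The number of cuts of `m`. -/
noncomputable def numCuts {n : ℕ} (m : Fin n → ℕ) : ℕ :=
  {p : Fin n × Fin n | IsCut m p.1 p.2}.ncard

/-!
A permutation at Ulam distance at most `1` from `σ` arises from `σ` by moving one entry, so the
sphere of radius `1` around `m` consists of the words obtained from `m` by moving one letter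
(`mem_ulamSphere_one_iff`). A move that changes `m` may be trimmed so that it changes the two ends
of the interval `[p, q]` on which it acts, and then `p`, `q` are determined by the resulting word.
Moves to the right and moves to the left give the same word exactly when `m` alternates on `[p, q]`
and `q - p` is odd (`rotL_eq_rotR_iff`).

For a balanced word, summation by parts shows that the trimmed moves in the two directions together
number `r` times the number of runs of equal letters
(`card_leftMoves_add_card_rightMoves`). A word with `c` cuts has `n + 1 - c` runs, and a cut of
length `k` contains `⌊k² / 4⌋` pairs of positions at odd distance. Hence the sphere has
`1 + (n + 1) r - (c r + ∑ ⌊k² / 4⌋)` elements, where `k` runs over the cut lengths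
(`ncard_ulamSphere_one_eq`), and the cost `c r + ∑ ⌊k² / 4⌋` has to be minimized.

The cut lengths of a balanced word add up to `n` and are not all odd, because odd cuts that follow
each other all contribute the same sign to the excess of one letter over the other
(`exists_even_mem_cutList`). Conversely every list of positive lengths with even sum and an even
entry can be arranged into the cut lengths of a balanced word (`exists_balanced_realizable`).
For the minimization, `⌊k² / 4⌋ ≥ d k - d²` for every integer `d`, with equality for
`|k - 2 d| ≤ 1`. With `s = ⌊√r⌋`, the resulting lower bounds of the cost for `d = s` and
`d = s + 1` are linear in `c`, nondecreasing and decreasing respectively. The larger of the two is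
attained by the nearly equal parts when `c` is the integer nearest to `√r`, except that an extra `1`
appears when these parts would all be odd (`cost_cutLengths_optimalCuts_le`).
-/

/-! ### The sphere of radius one as a set of moves of a letter -/

/-- The sequence on `ℕ` that agrees with the tuple `m` on its index range and vanishes
beyond it. -/
def zeroExtend {n : ℕ} (m : Fin n → ℕ) : ℕ → ℕ :=
  fun i => if h : i < n then m ⟨i, h⟩ else 0

/-- The sequence obtained from `x` by moving the entry at `p` right to position `q`
(meant for `p ≤ q`). -/
def rotL (p q : ℕ) (x : ℕ → ℕ) : ℕ → ℕ :=
  fun i => if p ≤ i ∧ i < q then x (i + 1) else if i = q then x p else x i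

/-- The sequence obtained from `x` by moving the entry at `q` left to position `p`
(meant for `p ≤ q`). -/
def rotR (p q : ℕ) (x : ℕ → ℕ) : ℕ → ℕ :=
  fun i => if p < i ∧ i ≤ q then x (i - 1) else if i = p then x q else x i

/-- The sequences obtained from `x` by moving one of the first `n` entries to another place
among the first `n`. -/
def translocations (n : ℕ) (x : ℕ → ℕ) : Set (ℕ → ℕ) :=
  {y | ∃ p q, p ≤ q ∧ q < n ∧ (y = rotL p q x ∨ y = rotR p q x)}

/-- The permutation with `j ↦ i` that is increasing from the complement of `j` to the
complement of `i`. -/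
def slide {N : ℕ} (j i : Fin (N + 1)) : Equiv.Perm (Fin (N + 1)) :=
  (finSuccEquiv' j).trans (finSuccEquiv' i).symm

theorem slide_self {N : ℕ} (j i : Fin (N + 1)) : slide j i j = i := by
  simp [slide]

theorem slide_succAbove {N : ℕ} (j i : Fin (N + 1)) (k : Fin N) :
    slide j i (j.succAbove k) = i.succAbove k := by
  simp [slide]

theorem strictMono_eq_succAbove {N : ℕ} {f : Fin N → Fin (N + 1)} (hf : StrictMono f) :
    ∃ i : Fin (N + 1), f = i.succAbove := by
  obtain ⟨i, hi⟩ : ∃ i, i ∉ Set.range f := by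
    by_contra! h
    have := Fintype.card_le_of_surjective f h
    simp at this
  refine ⟨i, (StrictMono.range_inj hf (Fin.strictMono_succAbove i)).1 ?_⟩
  rw [Fin.range_succAbove]
  have hsub : Set.range f ⊆ {i}ᶜ := by
    rintro _ ⟨k, rfl⟩ h
    exact hi ⟨k, h⟩
  apply Set.eq_of_subset_of_ncard_le hsub
  rw [Set.ncard_compl, Set.ncard_singleton, ← Set.image_univ,
    Set.ncard_image_of_injective _ hf.injective]
  simp

theorem lcsLength_bddAbove {α : Type*} {n : ℕ} (x y : Fin n → α) :
    BddAbove {k : ℕ | ∃ f g : Fin k → Fin n, StrictMono f ∧ StrictMono g ∧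
      ∀ l, x (f l) = y (g l)} := by
  refine ⟨n, ?_⟩
  rintro k ⟨f, g, hf, -⟩
  simpa using Fintype.card_le_of_injective f hf.injective

/-- Deleting one entry from each of two permutations leaves the same sequence exactly when one of
them arises from the other by moving a single entry. -/
theorem permUlamDist_le_one_iff {N : ℕ} (σ π : Equiv.Perm (Fin (N + 1))) :
    permUlamDist σ π ≤ 1 ↔ ∃ i j, ∀ l, π l = σ (slide j i l) := by
  constructor
  · intro h
    obtain ⟨f, g, hf, hg, hfg⟩ := Nat.sSup_mem
      (s := {k : ℕ | ∃ f g : Fin k → Fin (N + 1), StrictMono f ∧ StrictMono g ∧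
        ∀ l, σ (f l) = π (g l)})
      ⟨0, Fin.elim0, Fin.elim0, fun a => a.elim0, fun a => a.elim0, fun a => a.elim0⟩
      (lcsLength_bddAbove σ π)
    have hN : N ≤ lcsLength σ π := by
      unfold permUlamDist at h
      omega
    obtain ⟨i, hi⟩ := strictMono_eq_succAbove (f := fun k : Fin N => f (Fin.castLE hN k))
      (fun a b hab => hf (Fin.strictMono_castLE hN hab))
    obtain ⟨j, hj⟩ := strictMono_eq_succAbove (f := fun k : Fin N => g (Fin.castLE hN k))
      (fun a b hab => hg (Fin.strictMono_castLE hN hab))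
    have hk : ∀ k : Fin N, σ (i.succAbove k) = π (j.succAbove k) := by
      intro k
      rw [← hi, ← hj]
      exact hfg _
    refine ⟨i, j, fun l => ?_⟩
    rcases Fin.eq_self_or_eq_succAbove j l with hl | ⟨k, rfl⟩
    · rw [hl, slide_self]
      -- `σ⁻¹ (π j)` is not of the form `i.succAbove k`, so it can only be `i`
      rcases Fin.eq_self_or_eq_succAbove i (σ.symm (π l)) with h1 | ⟨k, h1⟩
      · rw [← h1]; simp [hl]
      · have h2 : π j = π (j.succAbove k) := by
          rw [← hk, ← h1]; simp [hl]
        exact absurd (π.injective h2).symm (Fin.succAbove_ne j k)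
    · rw [slide_succAbove, hk]
  · rintro ⟨i, j, h⟩
    have : N ≤ lcsLength σ π := by
      refine le_csSup (lcsLength_bddAbove σ π)
        ⟨i.succAbove, j.succAbove, Fin.strictMono_succAbove i, Fin.strictMono_succAbove j, ?_⟩
      intro l
      rw [h, slide_succAbove]
    unfold permUlamDist
    omega

/-- A move of an entry of `m` lifts to a move of an entry of any permutation representing `m`. -/
theorem mem_ulamSphere_one_iff {N r : ℕ} {m : Fin (N + 1) → ℕ} (hm : m ∈ multiperms (N + 1) r)
    (y : Fin (N + 1) → ℕ) :
    y ∈ ulamSphere r m 1 ↔ ∃ i j, y = m ∘ slide j i := by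
  constructor
  · rintro ⟨⟨π₀, h₀⟩, hd⟩
    obtain ⟨σ₀, h₁⟩ := hm
    obtain ⟨σ, π, rfl, rfl, h⟩ := Nat.sInf_mem
      (s := {d : ℕ | ∃ σ π : Equiv.Perm (Fin (N + 1)),
        multiperm r σ = m ∧ multiperm r π = y ∧ d = permUlamDist σ π})
      ⟨_, σ₀, π₀, h₁, h₀, rfl⟩
    obtain ⟨i, j, hl⟩ := (permUlamDist_le_one_iff σ π).1 (h ▸ hd)
    refine ⟨i, j, funext fun l => ?_⟩
    simp [multiperm, hl]
  · rintro ⟨i, j, rfl⟩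
    obtain ⟨σ, rfl⟩ := hm
    refine ⟨⟨(slide j i).trans σ, rfl⟩, ?_⟩
    have h : ulamDist r (multiperm r σ) (multiperm r ((slide j i).trans σ)) ≤
        permUlamDist σ ((slide j i).trans σ) := Nat.sInf_le ⟨σ, _, rfl, rfl, rfl⟩
    exact h.trans ((permUlamDist_le_one_iff _ _).2 ⟨i, j, fun l => rfl⟩)

theorem slide_val_of_le {N : ℕ} {j i : Fin (N + 1)} (h : i ≤ j) (l : Fin (N + 1)) :
    (slide j i l : ℕ) =
      if (i : ℕ) ≤ l ∧ (l : ℕ) < j then (l : ℕ) + 1 else if (l : ℕ) = j then (i : ℕ) else l := by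
  have h' : (i : ℕ) ≤ j := h
  rcases Fin.eq_self_or_eq_succAbove j l with rfl | ⟨k, rfl⟩
  · simp [slide_self]
  · rw [slide_succAbove]
    simp only [Fin.succAbove, Fin.lt_def, Fin.val_castSucc]
    split_ifs <;> simp_all <;> omega

theorem slide_val_of_ge {N : ℕ} {j i : Fin (N + 1)} (h : j ≤ i) (l : Fin (N + 1)) :
    (slide j i l : ℕ) =
      if (j : ℕ) < l ∧ (l : ℕ) ≤ i then (l : ℕ) - 1 else if (l : ℕ) = j then (i : ℕ) else l := by
  have h' : (j : ℕ) ≤ i := h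
  rcases Fin.eq_self_or_eq_succAbove j l with rfl | ⟨k, rfl⟩
  · simp [slide_self]
  · rw [slide_succAbove]
    simp only [Fin.succAbove, Fin.lt_def, Fin.val_castSucc]
    split_ifs <;> simp_all <;> omega

theorem zeroExtend_val {n : ℕ} (m : Fin n → ℕ) (i : Fin n) : zeroExtend m i = m i := by
  simp [zeroExtend]

theorem zeroExtend_injective (n : ℕ) : Function.Injective (zeroExtend (n := n)) := by
  intro a b h
  funext i
  rw [← zeroExtend_val a, ← zeroExtend_val b, h]

theorem zeroExtend_comp_slide_of_le {N : ℕ} (m : Fin (N + 1) → ℕ) {j i : Fin (N + 1)}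
    (h : i ≤ j) : zeroExtend (m ∘ slide j i) = rotL i j (zeroExtend m) := by
  funext l
  by_cases hl : l < N + 1
  · have e : zeroExtend (m ∘ slide j i) l = zeroExtend m (slide j i ⟨l, hl⟩ : ℕ) := by
      rw [zeroExtend_val]; simp [zeroExtend, hl]
    rw [e, slide_val_of_le h, rotL]
    split_ifs <;> rfl
  · have hj := j.isLt
    have : ¬ l < j := by omega
    have : l ≠ j := by omega
    simp [zeroExtend, rotL, *]

theorem zeroExtend_comp_slide_of_ge {N : ℕ} (m : Fin (N + 1) → ℕ) {j i : Fin (N + 1)}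
    (h : j ≤ i) : zeroExtend (m ∘ slide j i) = rotR j i (zeroExtend m) := by
  funext l
  by_cases hl : l < N + 1
  · have e : zeroExtend (m ∘ slide j i) l = zeroExtend m (slide j i ⟨l, hl⟩ : ℕ) := by
      rw [zeroExtend_val]; simp [zeroExtend, hl]
    rw [e, slide_val_of_ge h, rotR]
    split_ifs <;> rfl
  · have hj := j.isLt
    have hi := i.isLt
    have : ¬ l ≤ i := by omega
    have : l ≠ j := by omega
    simp [zeroExtend, rotR, *]

theorem ncard_ulamSphere_one {n r : ℕ} (hn : 0 < n) {m : Fin n → ℕ}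
    (hm : m ∈ multiperms n r) :
    (ulamSphere r m 1).ncard = (translocations n (zeroExtend m)).ncard := by
  obtain ⟨N, rfl⟩ : ∃ N, n = N + 1 := ⟨n - 1, by omega⟩
  rw [← Set.ncard_image_of_injective _ (zeroExtend_injective (N + 1))]
  congr 1
  ext y
  constructor
  · rintro ⟨z, hz, rfl⟩
    obtain ⟨i, j, rfl⟩ := (mem_ulamSphere_one_iff hm z).1 hz
    rcases le_total i j with h | h
    · exact ⟨i, j, h, j.isLt, Or.inl (zeroExtend_comp_slide_of_le m h)⟩
    · exact ⟨j, i, h, i.isLt, Or.inr (zeroExtend_comp_slide_of_ge m h)⟩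
  · rintro ⟨p, q, hpq, hq, rfl | rfl⟩
    · refine ⟨m ∘ slide ⟨q, hq⟩ ⟨p, by omega⟩, (mem_ulamSphere_one_iff hm _).2 ⟨_, _, rfl⟩, ?_⟩
      exact zeroExtend_comp_slide_of_le m (i := ⟨p, by omega⟩) (j := ⟨q, hq⟩) hpq
    · refine ⟨m ∘ slide ⟨p, by omega⟩ ⟨q, hq⟩, (mem_ulamSphere_one_iff hm _).2 ⟨_, _, rfl⟩, ?_⟩
      exact zeroExtend_comp_slide_of_ge m (j := ⟨p, by omega⟩) (i := ⟨q, hq⟩) hpq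

/-! ### Coincidences between moves -/

/-- The pairs `p < q` for which moving the entry at `p` right to `q` changes `x` at `p` and
at `q`, that is, `p` and `q` are the first and the last place of change. -/
def leftMoves (n : ℕ) (x : ℕ → ℕ) : Finset (ℕ × ℕ) :=
  {a ∈ Finset.range n ×ˢ Finset.range n |
    a.1 < a.2 ∧ x a.1 ≠ x (a.1 + 1) ∧ x a.2 ≠ x a.1}

/-- The pairs `p < q` for which moving the entry at `q` left to `p` changes `x` at `p` and
at `q`, that is, `p` and `q` are the first and the last place of change. -/
def rightMoves (n : ℕ) (x : ℕ → ℕ) : Finset (ℕ × ℕ) :=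
  {a ∈ Finset.range n ×ˢ Finset.range n |
    a.1 < a.2 ∧ x a.2 ≠ x (a.2 - 1) ∧ x a.2 ≠ x a.1}

/-- Neighbouring entries of `x` differ throughout the interval `[p, q]`. -/
def Alternates (x : ℕ → ℕ) (p q : ℕ) : Prop :=
  ∀ i, p ≤ i → i < q → x i ≠ x (i + 1)

open Classical in
/-- The pairs `p < q` such that `x` alternates on `[p, q]` and has different entries at the two
ends. -/
noncomputable def altPairs (n : ℕ) (x : ℕ → ℕ) : Finset (ℕ × ℕ) :=
  {a ∈ Finset.range n ×ˢ Finset.range n | a.1 < a.2 ∧ Alternates x a.1 a.2 ∧ x a.2 ≠ x a.1}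

theorem mem_leftMoves {n : ℕ} {x : ℕ → ℕ} {p q : ℕ} :
    (p, q) ∈ leftMoves n x ↔ q < n ∧ p < q ∧ x p ≠ x (p + 1) ∧ x q ≠ x p := by
  simp only [leftMoves, Finset.mem_filter, Finset.mem_product, Finset.mem_range]
  constructor
  · rintro ⟨⟨-, h⟩, h'⟩; exact ⟨h, h'⟩
  · rintro ⟨h, h'⟩; exact ⟨⟨by omega, h⟩, h'⟩

theorem mem_rightMoves {n : ℕ} {x : ℕ → ℕ} {p q : ℕ} :
    (p, q) ∈ rightMoves n x ↔ q < n ∧ p < q ∧ x q ≠ x (q - 1) ∧ x q ≠ x p := by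
  simp only [rightMoves, Finset.mem_filter, Finset.mem_product, Finset.mem_range]
  constructor
  · rintro ⟨⟨-, h⟩, h'⟩; exact ⟨h, h'⟩
  · rintro ⟨h, h'⟩; exact ⟨⟨by omega, h⟩, h'⟩

theorem mem_altPairs {n : ℕ} {x : ℕ → ℕ} {p q : ℕ} :
    (p, q) ∈ altPairs n x ↔ q < n ∧ p < q ∧ Alternates x p q ∧ x q ≠ x p := by
  simp only [altPairs, Finset.mem_filter, Finset.mem_product, Finset.mem_range]
  constructor
  · rintro ⟨⟨-, h⟩, h'⟩; exact ⟨h, h'⟩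
  · rintro ⟨h, h'⟩; exact ⟨⟨by omega, h⟩, h'⟩

theorem rotL_self (p : ℕ) (x : ℕ → ℕ) : rotL p p x = x := by
  funext i
  unfold rotL
  split_ifs with h1 h2
  · omega
  · rw [h2]
  · rfl

theorem rotR_self (p : ℕ) (x : ℕ → ℕ) : rotR p p x = x := by
  funext i
  unfold rotR
  split_ifs with h1 h2
  · omega
  · rw [h2]
  · rfl

theorem rotL_eq_succ {p q : ℕ} {x : ℕ → ℕ} (hpq : p < q) (h : x p = x (p + 1)) :
    rotL p q x = rotL (p + 1) q x := by
  funext i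
  by_cases hi : i = p
  · subst hi
    simp [rotL, hpq, hpq.ne, h]
  · have : p ≤ i ↔ p + 1 ≤ i := by omega
    simp [rotL, this, h]

theorem rotL_eq_pred {p q : ℕ} {x : ℕ → ℕ} (hpq : p < q + 1) (h : x (q + 1) = x p) :
    rotL p (q + 1) x = rotL p q x := by
  funext i
  unfold rotL
  rcases lt_trichotomy i q with hi | rfl | hi
  · have h1 : i < q + 1 := by omega
    have h2 : i ≠ q + 1 := by omega
    simp [hi, h1, h2, hi.ne]
  · have : p ≤ i := by omega
    simp [this, h]
  · have h1 : ¬ i < q := by omega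
    have h2 : ¬ i < q + 1 := by omega
    simp only [h1, h2, hi.ne', and_false, if_false]
    split_ifs with h3
    · rw [h3, h]
    · rfl

theorem rotR_eq_pred {p q : ℕ} {x : ℕ → ℕ} (hpq : p < q + 1) (h : x (q + 1) = x q) :
    rotR p (q + 1) x = rotR p q x := by
  funext i
  by_cases hi : i = q + 1
  · subst hi
    have : q + 1 ≠ p := by omega
    simp [rotR, hpq, this, h]
  · have : i ≤ q + 1 ↔ i ≤ q := by omega
    simp [rotR, this, h]

theorem rotR_eq_succ {p q : ℕ} {x : ℕ → ℕ} (hpq : p < q) (h : x q = x p) :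
    rotR p q x = rotR (p + 1) q x := by
  funext i
  unfold rotR
  rcases lt_trichotomy i (p + 1) with hi | rfl | hi
  · have h1 : ¬ p < i := by omega
    have h2 : ¬ p + 1 < i := by omega
    simp only [h1, h2, hi.ne, false_and, if_false]
    split_ifs with h3
    · rw [h3, h]
    · rfl
  · simp [hpq, h]
  · have h1 : p < i := by omega
    have h2 : i ≠ p := by omega
    simp [hi, h1, h2, hi.ne']

theorem rotL_eq_or_mem_leftMoves {n : ℕ} (x : ℕ → ℕ) (d : ℕ) : ∀ p q, q = p + d → q < n →
    rotL p q x = x ∨ ∃ a ∈ leftMoves n x, rotL p q x = rotL a.1 a.2 x := by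
  induction d with
  | zero =>
    rintro p _ rfl -
    exact Or.inl (rotL_self _ x)
  | succ d ih =>
    rintro p _ rfl hq
    by_cases h1 : x p = x (p + 1)
    · rw [rotL_eq_succ (by omega) h1]
      exact ih _ _ (by omega) hq
    by_cases h2 : x (p + d + 1) = x p
    · rw [← add_assoc, rotL_eq_pred (by omega) h2]
      exact ih _ _ rfl (by omega)
    · exact Or.inr ⟨(p, p + (d + 1)), mem_leftMoves.2 ⟨hq, by omega, h1, h2⟩, rfl⟩

theorem rotR_eq_or_mem_rightMoves {n : ℕ} (x : ℕ → ℕ) (d : ℕ) : ∀ p q, q = p + d → q < n →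
    rotR p q x = x ∨ ∃ a ∈ rightMoves n x, rotR p q x = rotR a.1 a.2 x := by
  induction d with
  | zero =>
    rintro p _ rfl -
    exact Or.inl (rotR_self _ x)
  | succ d ih =>
    rintro p _ rfl hq
    by_cases h1 : x (p + d + 1) = x (p + d)
    · rw [← add_assoc, rotR_eq_pred (by omega) h1]
      exact ih _ _ rfl (by omega)
    by_cases h2 : x (p + d + 1) = x p
    · rw [← add_assoc, rotR_eq_succ (by omega) h2]
      exact ih _ _ (by omega) hq
    · exact Or.inr ⟨(p, p + (d + 1)), mem_rightMoves.2 ⟨hq, by omega, h1, h2⟩, rfl⟩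

/-- Discarding the moves that do not change `x` at both ends loses no sequence. -/
theorem translocations_eq {n : ℕ} (hn : 0 < n) (x : ℕ → ℕ) :
    translocations n x = insert x
      ((fun a : ℕ × ℕ => rotL a.1 a.2 x) '' leftMoves n x ∪
        (fun a : ℕ × ℕ => rotR a.1 a.2 x) '' rightMoves n x) := by
  ext y
  constructor
  · rintro ⟨p, q, hpq, hq, rfl | rfl⟩
    · rcases rotL_eq_or_mem_leftMoves x (q - p) p q (by omega) hq with h | ⟨a, ha, h⟩
      · exact Or.inl h
      · exact Or.inr (Or.inl ⟨a, ha, h.symm⟩)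
    · rcases rotR_eq_or_mem_rightMoves x (q - p) p q (by omega) hq with h | ⟨a, ha, h⟩
      · exact Or.inl h
      · exact Or.inr (Or.inr ⟨a, ha, h.symm⟩)
  · rintro (rfl | ⟨⟨p, q⟩, h, rfl⟩ | ⟨⟨p, q⟩, h, rfl⟩)
    · exact ⟨0, 0, le_rfl, hn, Or.inl (rotL_self 0 y).symm⟩
    · obtain ⟨h1, h2, -⟩ := mem_leftMoves.1 h
      exact ⟨p, q, h2.le, h1, Or.inl rfl⟩
    · obtain ⟨h1, h2, -⟩ := mem_rightMoves.1 h
      exact ⟨p, q, h2.le, h1, Or.inr rfl⟩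

/-- `p` and `q` are the first and the last place where `y` differs from `x`. -/
def ChangeSpan (x y : ℕ → ℕ) (p q : ℕ) : Prop :=
  y p ≠ x p ∧ y q ≠ x q ∧ ∀ i, y i ≠ x i → p ≤ i ∧ i ≤ q

theorem ChangeSpan.unique {x y : ℕ → ℕ} {p q p' q' : ℕ} (h : ChangeSpan x y p q)
    (h' : ChangeSpan x y p' q') : (p, q) = (p', q') := by
  have h1 := h.2.2 _ h'.1
  have h2 := h.2.2 _ h'.2.1
  have h3 := h'.2.2 _ h.1
  have h4 := h'.2.2 _ h.2.1
  ext <;> simp only <;> omega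

theorem changeSpan_rotL {n : ℕ} {x : ℕ → ℕ} {p q : ℕ} (h : (p, q) ∈ leftMoves n x) :
    ChangeSpan x (rotL p q x) p q := by
  obtain ⟨-, hpq, h1, h2⟩ := mem_leftMoves.1 h
  refine ⟨?_, ?_, ?_⟩
  · simpa [rotL, hpq] using h1.symm
  · simpa [rotL] using h2.symm
  · intro i hi
    by_contra hc
    apply hi
    have h3 : ¬ (p ≤ i ∧ i < q) := by omega
    have h4 : i ≠ q := by omega
    simp [rotL, h3, h4]

theorem changeSpan_rotR {n : ℕ} {x : ℕ → ℕ} {p q : ℕ} (h : (p, q) ∈ rightMoves n x) :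
    ChangeSpan x (rotR p q x) p q := by
  obtain ⟨-, hpq, h1, h2⟩ := mem_rightMoves.1 h
  refine ⟨?_, ?_, ?_⟩
  · simpa [rotR] using h2
  · simpa [rotR, hpq] using h1.symm
  · intro i hi
    by_contra hc
    apply hi
    have h3 : ¬ (p < i ∧ i ≤ q) := by omega
    have h4 : i ≠ p := by omega
    simp [rotR, h3, h4]

/-- The two rotations of `x` on `[p, q]` agree exactly when `x` alternates there. -/
theorem rotL_eq_rotR_iff {n : ℕ} {x : ℕ → ℕ} (hx : ∀ i < n, x i = 1 ∨ x i = 2) {p q : ℕ} :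
    ((p, q) ∈ leftMoves n x ∧ (p, q) ∈ rightMoves n x ∧ rotL p q x = rotR p q x) ↔
      (p, q) ∈ altPairs n x := by
  rw [mem_leftMoves, mem_rightMoves, mem_altPairs]
  constructor
  · rintro ⟨⟨hq, hpq, h1, h2⟩, ⟨-, -, h3, -⟩, heq⟩
    refine ⟨hq, hpq, ?_, h2⟩
    intro i hi
    induction i, hi using Nat.le_induction with
    | base => exact fun _ => h1
    | succ i hi ih =>
      intro hiq
      have h4 := congrFun heq (i + 1)
      have h5 : p ≤ i + 1 := by omega
      have h6 : p < i + 1 := by omega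
      simp only [rotL, rotR, h5, h6, hiq, hiq.le, and_self, if_true, Nat.add_sub_cancel] at h4
      rw [h4]
      exact (ih (by omega)).symm
  · rintro ⟨hq, hpq, ha, h2⟩
    have h1 := ha p le_rfl hpq
    have h3 : x q ≠ x (q - 1) := by
      have := ha (q - 1) (by omega) (by omega)
      rw [Nat.sub_add_cancel (by omega)] at this
      exact this.symm
    refine ⟨⟨hq, hpq, h1, h2⟩, ⟨hq, hpq, h3, h2⟩, ?_⟩
    funext i
    have hp' := hx p (by omega)
    have hq' := hx q hq
    unfold rotL rotR
    rcases lt_trichotomy i p with hi | rfl | hi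
    · have e1 : ¬ (p ≤ i ∧ i < q) := by omega
      have e2 : ¬ (p < i ∧ i ≤ q) := by omega
      simp [e1, e2, hi.ne, (hi.trans hpq).ne]
    · have := hx (i + 1) (by omega)
      simp only [hpq, le_refl, and_self, lt_irrefl, false_and, if_true, if_false]
      omega
    rcases lt_trichotomy i q with hi' | rfl | hi'
    · have e1 := ha i hi.le hi'
      have e2 := ha (i - 1) (by omega) (by omega)
      rw [Nat.sub_add_cancel (by omega)] at e2
      have := hx i (by omega)
      have := hx (i + 1) (by omega)
      have := hx (i - 1) (by omega)
      simp only [hi, hi', hi.le, hi'.le, and_self, if_true]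
      omega
    · have := hx (i - 1) (by omega)
      simp only [hi, lt_irrefl, and_false, le_refl, and_self, if_true, if_false]
      omega
    · have e1 : ¬ (p ≤ i ∧ i < q) := by omega
      have e2 : ¬ (p < i ∧ i ≤ q) := by omega
      simp [e1, e2, hi.ne', hi'.ne']

/-- Inclusion and exclusion: the first and the last place of change determine a move up to its
direction, and the two directions give the same sequence only on alternating blocks. -/
theorem ncard_translocations {n : ℕ} (hn : 0 < n) {x : ℕ → ℕ}
    (hx : ∀ i < n, x i = 1 ∨ x i = 2) :
    (translocations n x).ncard + (altPairs n x).card =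
      1 + (leftMoves n x).card + (rightMoves n x).card := by
  classical
  set A := (leftMoves n x).image (fun a : ℕ × ℕ => rotL a.1 a.2 x) with hA
  set B := (rightMoves n x).image (fun a : ℕ × ℕ => rotR a.1 a.2 x) with hB
  have hS : translocations n x = ((insert x (A ∪ B) : Finset (ℕ → ℕ)) : Set (ℕ → ℕ)) := by
    rw [translocations_eq hn]
    simp [hA, hB]
  have hxA : x ∉ A ∪ B := by
    intro h
    rcases Finset.mem_union.1 h with h | h
    · obtain ⟨⟨p, q⟩, ha, h⟩ := Finset.mem_image.1 h
      exact (changeSpan_rotL ha).1 (congrFun h p)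
    · obtain ⟨⟨p, q⟩, ha, h⟩ := Finset.mem_image.1 h
      exact (changeSpan_rotR ha).1 (congrFun h p)
  have hAc : A.card = (leftMoves n x).card := by
    apply Finset.card_image_of_injOn
    rintro ⟨p, q⟩ h ⟨p', q'⟩ h' e
    have := changeSpan_rotL h
    simp only at e
    rw [e] at this
    exact this.unique (changeSpan_rotL h')
  have hBc : B.card = (rightMoves n x).card := by
    apply Finset.card_image_of_injOn
    rintro ⟨p, q⟩ h ⟨p', q'⟩ h' e
    have := changeSpan_rotR h
    simp only at e
    rw [e] at this
    exact this.unique (changeSpan_rotR h')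
  have hI : A ∩ B = (altPairs n x).image (fun a : ℕ × ℕ => rotL a.1 a.2 x) := by
    ext y
    simp only [Finset.mem_inter, hA, hB, Finset.mem_image]
    constructor
    · rintro ⟨⟨⟨p, q⟩, h, rfl⟩, ⟨⟨p', q'⟩, h', e⟩⟩
      have hc := changeSpan_rotR h'
      simp only at e
      rw [e] at hc
      obtain ⟨rfl, rfl⟩ := Prod.mk.inj ((changeSpan_rotL h).unique hc)
      exact ⟨(p, q), (rotL_eq_rotR_iff hx).1 ⟨h, h', e.symm⟩, rfl⟩
    · rintro ⟨⟨p, q⟩, h, rfl⟩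
      obtain ⟨h1, h2, h3⟩ := (rotL_eq_rotR_iff hx).2 h
      exact ⟨⟨(p, q), h1, rfl⟩, ⟨(p, q), h2, h3.symm⟩⟩
  have hIc : (A ∩ B).card = (altPairs n x).card := by
    rw [hI]
    apply Finset.card_image_of_injOn
    rintro ⟨p, q⟩ h ⟨p', q'⟩ h' e
    have := changeSpan_rotL ((rotL_eq_rotR_iff hx).2 h).1
    simp only at e
    rw [e] at this
    exact this.unique (changeSpan_rotL ((rotL_eq_rotR_iff hx).2 h').1)
  rw [hS, Set.ncard_coe_finset, Finset.card_insert_of_notMem hxA]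
  have := Finset.card_union_add_card_inter A B
  omega

/-! ### Counting moves in a balanced word -/

/-- The letters `1` and `2` as the signs `1` and `-1`. -/
def letterSign (a : ℕ) : ℤ := 3 - 2 * a

/-- The excess of ones over twos among the first `k` entries of `x`. -/
def excess (x : ℕ → ℕ) (k : ℕ) : ℤ := ∑ i ∈ Finset.range k, letterSign (x i)

theorem excess_succ (x : ℕ → ℕ) (k : ℕ) : excess x (k + 1) = excess x k + letterSign (x k) :=
  Finset.sum_range_succ _ _

/-- The number of neighbouring entries that differ among the first `N + 1` entries of `x`. -/
def numChanges (x : ℕ → ℕ) (N : ℕ) : ℕ :=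
  ∑ i ∈ Finset.range N, if x i ≠ x (i + 1) then 1 else 0

theorem two_mul_card_eq {x : ℕ → ℕ} {a : ℕ} (ha : a = 1 ∨ a = 2) (k : ℕ)
    (hx : ∀ i < k, x i = 1 ∨ x i = 2) :
    2 * (((Finset.range k).filter fun i => x i = a).card : ℤ) =
      k + letterSign a * excess x k := by
  induction k with
  | zero => simp [excess]
  | succ k ih =>
    specialize ih fun i hi => hx i (by omega)
    rw [Finset.range_add_one, Finset.filter_insert, excess_succ]
    rcases hx k (by omega) with h | h <;> rcases ha with rfl | rfl <;>
      simp only [h, letterSign, if_true, if_false, OfNat.ofNat_ne_one, OfNat.one_ne_ofNat,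
        Finset.card_insert_of_notMem, Finset.mem_filter, Finset.mem_range, lt_irrefl, false_and,
        not_false_eq_true] at ih ⊢ <;> push_cast at ih ⊢ <;> linarith

theorem two_mul_card_ne {x : ℕ → ℕ} {a : ℕ} (ha : a = 1 ∨ a = 2) (k : ℕ)
    (hx : ∀ i < k, x i = 1 ∨ x i = 2) :
    2 * (((Finset.range k).filter fun i => x i ≠ a).card : ℤ) =
      k - letterSign a * excess x k := by
  have h1 := two_mul_card_eq ha k hx
  have h2 := Finset.card_filter_add_card_filter_not (s := Finset.range k) (fun i => x i = a)
  rw [Finset.card_range] at h2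
  have h3 : (((Finset.range k).filter fun i => x i = a).card : ℤ) +
      ((Finset.range k).filter fun i => ¬ x i = a).card = k := by exact_mod_cast h2
  simp only [ne_eq]
  linarith

theorem card_leftMoves (N : ℕ) (x : ℕ → ℕ) :
    (leftMoves (N + 1) x).card = ∑ p ∈ Finset.range N, if x p ≠ x (p + 1) then
      ((Finset.range (N + 1)).filter fun q => p < q ∧ x q ≠ x p).card else 0 := by
  rw [leftMoves, Finset.card_filter, Finset.sum_product, Finset.sum_range_succ]
  have h0 : ∑ q ∈ Finset.range (N + 1),
      (if N < q ∧ x N ≠ x (N + 1) ∧ x q ≠ x N then 1 else 0) = 0 := by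
    apply Finset.sum_eq_zero
    intro q hq
    have : ¬ N < q := by have := Finset.mem_range.1 hq; omega
    simp [this]
  simp only [h0, add_zero]
  apply Finset.sum_congr rfl
  intro p _
  rw [Finset.card_filter]
  split_ifs with h <;> simp [h]

theorem card_rightMoves (N : ℕ) (x : ℕ → ℕ) :
    (rightMoves (N + 1) x).card = ∑ p ∈ Finset.range N, if x p ≠ x (p + 1) then
      ((Finset.range (p + 1)).filter fun q => x q ≠ x (p + 1)).card else 0 := by
  rw [rightMoves, Finset.card_filter, Finset.sum_product_right, Finset.sum_range_succ']
  simp only [not_lt_zero, false_and, if_false, Finset.sum_const_zero, add_zero,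
    Nat.add_sub_cancel]
  apply Finset.sum_congr rfl
  intro p hp
  have hp := Finset.mem_range.1 hp
  rw [← Finset.card_filter]
  split_ifs with h
  · congr 1
    ext q
    simp only [Finset.mem_filter, Finset.mem_range, ne_comm (a := x (p + 1)) (b := x p), h,
      ne_eq, not_false_eq_true, true_and]
    constructor
    · rintro ⟨-, h1, h2⟩
      exact ⟨h1, fun h => h2 h.symm⟩
    · rintro ⟨h1, h2⟩
      exact ⟨by omega, h1, fun h => h2 h.symm⟩
  · rw [Finset.card_eq_zero, Finset.filter_eq_empty_iff]
    rintro q - ⟨-, h1, -⟩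
    exact h fun h2 => h1 h2.symm

/-- Summation by parts: at a change of letter, the sign is half the difference of consecutive
signs. -/
theorem sum_sign_mul_excess {x : ℕ → ℕ} (N : ℕ) (hx : ∀ i < N + 1, x i = 1 ∨ x i = 2) :
    2 * ∑ p ∈ Finset.range N,
        (if x p ≠ x (p + 1) then letterSign (x p) * excess x (p + 1) else 0) =
      N + 1 - letterSign (x N) * excess x (N + 1) := by
  induction N with
  | zero => rcases hx 0 (by omega) with h | h <;> simp [excess, letterSign, h]
  | succ N ih =>
    specialize ih fun i hi => hx i (by omega)
    rw [Finset.sum_range_succ, mul_add, ih, excess_succ x (N + 1)]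
    rcases hx N (by omega) with h | h <;> rcases hx (N + 1) (by omega) with h' | h' <;>
      simp [h, h', letterSign] <;> ring

/-- In a balanced word each change of letter contributes `r` moves, up to a correction that sums
to `r`. -/
theorem card_leftMoves_add_card_rightMoves {x : ℕ → ℕ} {N r : ℕ} (hN : N + 1 = 2 * r)
    (hx : ∀ i < N + 1, x i = 1 ∨ x i = 2) (hb : excess x (N + 1) = 0) :
    (leftMoves (N + 1) x).card + (rightMoves (N + 1) x).card = numChanges x N * r + r := by
  have key : ∀ p ∈ Finset.range N,
      2 * (((if x p ≠ x (p + 1) then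
        ((Finset.range (N + 1)).filter fun q => p < q ∧ x q ≠ x p).card else 0 : ℕ) : ℤ) +
      ((if x p ≠ x (p + 1) then
        ((Finset.range (p + 1)).filter fun q => x q ≠ x (p + 1)).card else 0 : ℕ) : ℤ)) =
      2 * r * (if x p ≠ x (p + 1) then 1 else 0 : ℕ) +
        2 * (if x p ≠ x (p + 1) then letterSign (x p) * excess x (p + 1) else 0) := by
    intro p hp
    have hp := Finset.mem_range.1 hp
    split_ifs with h
    swap
    · simp
    have hxp := hx p (by omega)
    have hxp' := hx (p + 1) (by omega)
    have h1 := two_mul_card_ne hxp (N + 1) hx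
    have h2 := two_mul_card_ne hxp (p + 1) fun i hi => hx i (by omega)
    have h3 := two_mul_card_ne hxp' (p + 1) fun i hi => hx i (by omega)
    have h4 : letterSign (x (p + 1)) = - letterSign (x p) := by
      unfold letterSign
      omega
    have h5 : ((Finset.range (N + 1)).filter fun q => x q ≠ x p).card =
        ((Finset.range (N + 1)).filter fun q => p < q ∧ x q ≠ x p).card +
          ((Finset.range (p + 1)).filter fun q => x q ≠ x p).card := by
      rw [← Finset.card_filter_add_card_filter_not (fun q => p < q), Finset.filter_filter,
        Finset.filter_filter]
      congr 2
      · ext q; simp only [Finset.mem_filter]; tauto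
      · ext q
        simp only [Finset.mem_filter, Finset.mem_range]
        constructor
        · rintro ⟨-, h1, h2⟩; exact ⟨by omega, h1⟩
        · rintro ⟨h1, h2⟩; exact ⟨by omega, h2, by omega⟩
    rw [hb, h5] at h1
    rw [h4] at h3
    push_cast at h1 h2 h3 ⊢
    have hN' : (N : ℤ) + 1 = 2 * r := by exact_mod_cast hN
    linarith
  have hsum := Finset.sum_congr rfl key
  rw [← Finset.mul_sum, Finset.sum_add_distrib, Finset.sum_add_distrib, ← Finset.mul_sum,
    ← Finset.mul_sum, sum_sign_mul_excess N hx, hb, ← Nat.cast_sum, ← Nat.cast_sum,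
    ← Nat.cast_sum, ← card_leftMoves, ← card_rightMoves] at hsum
  have hN' : (N : ℤ) + 1 = 2 * r := by exact_mod_cast hN
  rw [← Nat.cast_inj (R := ℤ)]
  unfold numChanges
  push_cast at hsum ⊢
  linarith

/-! ### Cut lengths of a word -/

/-- The lengths of the cuts of the word formed by the first `n` entries of `x`, the last cut
first. -/
def cutList (x : ℕ → ℕ) : ℕ → List ℕ
  | 0 => []
  | n + 1 =>
    match cutList x n with
    | [] => [1]
    | h :: t => if x (n - 1) ≠ x n then (h + 1) :: t else 1 :: h :: t

theorem cutList_succ_of_eq_cons {x : ℕ → ℕ} {n h : ℕ} {t : List ℕ}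
    (e : cutList x (n + 1) = h :: t) :
    cutList x (n + 2) = if x n ≠ x (n + 1) then (h + 1) :: t else 1 :: h :: t := by
  rw [cutList, e]
  rfl

theorem alternates_self (x : ℕ → ℕ) (p : ℕ) : Alternates x p p :=
  fun i h1 h2 => absurd h1 (by omega)

theorem alternates_succ_iff {x : ℕ → ℕ} {p n : ℕ} (hp : p ≤ n) :
    Alternates x p (n + 1) ↔ Alternates x p n ∧ x n ≠ x (n + 1) := by
  constructor
  · intro h
    exact ⟨fun i h1 h2 => h i h1 (by omega), h n hp (by omega)⟩
  · rintro ⟨h, h'⟩ i h1 h2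
    rcases Nat.lt_succ_iff_lt_or_eq.1 h2 with h3 | rfl
    · exact h i h1 h3
    · exact h'

/-- The head of the list of cut lengths is the length of the longest alternating block that ends
at the last entry. -/
theorem exists_cutList_eq_cons (x : ℕ → ℕ) (N : ℕ) :
    ∃ h t, cutList x (N + 1) = h :: t ∧ 1 ≤ h ∧ h + t.sum = N + 1 ∧
      t.length + numChanges x N = N ∧
      ∀ p ≤ N, (Alternates x p N ↔ N < p + h) := by
  induction N with
  | zero =>
    refine ⟨1, [], rfl, le_rfl, rfl, rfl, ?_⟩
    intro p hp
    obtain rfl : p = 0 := by omega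
    simp [alternates_self]
  | succ N ih =>
    obtain ⟨h, t, e, h1, hs, hl, ha⟩ := ih
    have e' := cutList_succ_of_eq_cons e
    have hc : numChanges x (N + 1) = numChanges x N + if x N ≠ x (N + 1) then 1 else 0 :=
      Finset.sum_range_succ _ _
    by_cases hx : x N ≠ x (N + 1)
    · rw [if_pos hx] at e' hc
      refine ⟨h + 1, t, e', by omega, by omega, by omega, ?_⟩
      intro p hp
      rcases Nat.le_succ_iff.1 hp with hp | rfl
      · rw [alternates_succ_iff hp, ha p hp]
        constructor
        · rintro ⟨h2, -⟩; omega
        · intro h2; exact ⟨by omega, hx⟩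
      · simp [alternates_self]
    · rw [if_neg hx] at e' hc
      refine ⟨1, h :: t, e', by omega, by simp; omega, by simp; omega, ?_⟩
      intro p hp
      rcases Nat.le_succ_iff.1 hp with hp | rfl
      · rw [alternates_succ_iff hp]
        constructor
        · rintro ⟨-, h2⟩; exact absurd h2 hx
        · intro h2; omega
      · simp [alternates_self]

theorem cutList_sum (x : ℕ → ℕ) (n : ℕ) : (cutList x n).sum = n := by
  cases n with
  | zero => rfl
  | succ N =>
    obtain ⟨h, t, e, -, hs, -⟩ := exists_cutList_eq_cons x N
    rw [e, List.sum_cons, hs]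

theorem cutList_length (x : ℕ → ℕ) (N : ℕ) :
    (cutList x (N + 1)).length + numChanges x N = N + 1 := by
  obtain ⟨h, t, e, -, -, hl, -⟩ := exists_cutList_eq_cons x N
  rw [e, List.length_cons]
  omega

theorem cutList_congr {x y : ℕ → ℕ} (n : ℕ) (h : ∀ i < n, x i = y i) :
    cutList x n = cutList y n := by
  induction n with
  | zero => rfl
  | succ n ih =>
    rw [cutList, cutList, ih fun i hi => h i (by omega)]
    cases n with
    | zero => simp [cutList]
    | succ n => rw [h _ (Nat.lt_succ_self _), h (n + 1 - 1) (by omega)]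

theorem card_filter_odd_sub (n h : ℕ) (hn : h ≤ n + 1) :
    ((Finset.range n).filter fun p => n < p + h ∧ Odd (n - p)).card = h / 2 := by
  induction h with
  | zero =>
    rw [Nat.zero_div, Finset.card_eq_zero, Finset.filter_eq_empty_iff]
    rintro p hp ⟨h1, -⟩
    have := Finset.mem_range.1 hp
    omega
  | succ h ih =>
    specialize ih (by omega)
    rcases Nat.even_or_odd h with he | ho
    · have : (h + 1) / 2 = h / 2 := by obtain ⟨a, rfl⟩ := he; omega
      rw [this, ← ih]
      congr 1
      ext p
      simp only [Finset.mem_filter, Finset.mem_range]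
      constructor
      · rintro ⟨h1, h2, h3⟩
        refine ⟨h1, ?_, h3⟩
        by_contra h4
        obtain rfl : h = n - p := by omega
        exact (Nat.not_even_iff_odd.2 h3) he
      · rintro ⟨h1, h2, h3⟩
        exact ⟨h1, by omega, h3⟩
    · have h0 : (h + 1) / 2 = h / 2 + 1 := by obtain ⟨a, rfl⟩ := ho; omega
      have hpos := ho.pos
      rw [h0, ← ih, ← Finset.card_insert_of_notMem (a := n - h)]
      · congr 1
        ext p
        simp only [Finset.mem_filter, Finset.mem_range, Finset.mem_insert]
        constructor
        · rintro ⟨h1, h2, h3⟩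
          by_cases h4 : p = n - h
          · exact Or.inl h4
          · exact Or.inr ⟨h1, by omega, h3⟩
        · rintro (rfl | ⟨h1, h2, h3⟩)
          · refine ⟨by omega, by omega, ?_⟩
            rwa [Nat.sub_sub_self (by omega)]
          · exact ⟨h1, by omega, h3⟩
      · simp only [Finset.mem_filter, Finset.mem_range, not_and]
        intro h1 h2
        omega

theorem ne_iff_odd_of_alternates {x : ℕ → ℕ} {n p : ℕ} (hx : ∀ i < n, x i = 1 ∨ x i = 2)
    (d : ℕ) (hd : p + d < n) (h : Alternates x p (p + d)) : x (p + d) ≠ x p ↔ Odd d := by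
  induction d with
  | zero => simp
  | succ d ih =>
    rw [← add_assoc, alternates_succ_iff (by omega)] at h
    have ih := ih (by omega) h.1
    have h1 := hx p (by omega)
    have h2 := hx (p + d) (by omega)
    have h3 := hx (p + (d + 1)) hd
    have h4 := h.2
    rw [add_assoc] at h4
    rw [Nat.odd_add_one, ← ih]
    omega

theorem card_altPairs_succ (n : ℕ) (x : ℕ → ℕ) (h : ℕ) (hn : h ≤ n + 1)
    (hx : ∀ i < n + 1, x i = 1 ∨ x i = 2)
    (ha : ∀ p ≤ n, (Alternates x p n ↔ n < p + h)) :
    (altPairs (n + 1) x).card = (altPairs n x).card + h / 2 := by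
  classical
  rw [← card_filter_odd_sub n h hn, ← Finset.card_image_of_injective
    ((Finset.range n).filter fun p => n < p + h ∧ Odd (n - p)) (Prod.mk_left_injective n),
    ← Finset.card_union_of_disjoint]
  · congr 1
    ext ⟨p, q⟩
    simp only [Finset.mem_union, mem_altPairs, Finset.mem_image, Finset.mem_filter,
      Finset.mem_range, Prod.mk.injEq]
    have key : ∀ p < n, Alternates x p n → (x n ≠ x p ↔ Odd (n - p)) := by
      intro p hp h1
      have := ne_iff_odd_of_alternates hx (p := p) (n - p) (by omega)
      rw [Nat.add_sub_cancel' hp.le] at this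
      exact this h1
    constructor
    · rintro ⟨h1, h2, h3, h4⟩
      rcases Nat.lt_succ_iff_lt_or_eq.1 h1 with h1 | rfl
      · exact Or.inl ⟨h1, h2, h3, h4⟩
      · exact Or.inr ⟨p, ⟨h2, (ha p h2.le).1 h3, (key p h2 h3).1 h4⟩, rfl, rfl⟩
    · rintro (⟨h1, h2, h3, h4⟩ | ⟨p, ⟨h1, h2, h3⟩, rfl, rfl⟩)
      · exact ⟨by omega, h2, h3, h4⟩
      · have h4 := (ha p h1.le).2 h2
        exact ⟨by omega, h1, h4, (key p h1 h4).2 h3⟩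
  · rw [Finset.disjoint_left]
    rintro ⟨p, q⟩ h1 h2
    obtain ⟨_, -, h3⟩ := Finset.mem_image.1 h2
    have := (mem_altPairs.1 h1).1
    have := (Prod.mk.inj h3).2
    omega

theorem succ_sq_div_four (h : ℕ) : (h + 1) ^ 2 / 4 = h ^ 2 / 4 + (h + 1) / 2 := by
  obtain ⟨a, rfl | rfl⟩ : ∃ a, h = 2 * a ∨ h = 2 * a + 1 := ⟨h / 2, by omega⟩
  · have h1 : (2 * a + 1) ^ 2 = 1 + 4 * (a ^ 2 + a) := by ring
    have h2 : (2 * a) ^ 2 = 4 * a ^ 2 := by ring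
    omega
  · have h1 : (2 * a + 1 + 1) ^ 2 = 4 * (a ^ 2 + 2 * a + 1) := by ring
    have h2 : (2 * a + 1) ^ 2 = 1 + 4 * (a ^ 2 + a) := by ring
    omega

/-- A cut of length `k` contains `⌊k² / 4⌋` pairs of positions at odd distance. -/
theorem card_altPairs (n : ℕ) (x : ℕ → ℕ) (hx : ∀ i < n, x i = 1 ∨ x i = 2) :
    (altPairs n x).card = ((cutList x n).map fun k => k ^ 2 / 4).sum := by
  induction n with
  | zero => simp [altPairs, cutList]
  | succ n ih =>
    obtain ⟨h, t, e, h1, hs, hl, ha⟩ := exists_cutList_eq_cons x n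
    rw [card_altPairs_succ n x h (by omega) hx ha, ih fun i hi => hx i (by omega)]
    cases n with
    | zero =>
      obtain rfl : h = 1 := by omega
      simp [cutList]
    | succ n =>
      obtain ⟨h', t', e', -⟩ := exists_cutList_eq_cons x n
      rw [cutList_succ_of_eq_cons e'] at e
      rw [cutList_succ_of_eq_cons e', e']
      split_ifs at e ⊢
      · obtain ⟨rfl, rfl⟩ := List.cons.inj e
        simp only [List.map_cons, List.sum_cons, succ_sq_div_four h']
        omega
      · obtain ⟨rfl, rfl⟩ := List.cons.inj e
        simp

/-- Cuts of odd length begin and end with the same letter, and so does the next cut: if all cuts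
have odd length, then they all contribute the same sign to the excess. -/
theorem excess_of_odd_cuts {x : ℕ → ℕ} (N : ℕ) (hx : ∀ i < N + 1, x i = 1 ∨ x i = 2) {h : ℕ}
    {t : List ℕ} (e : cutList x (N + 1) = h :: t) (ht : ∀ k ∈ t, Odd k) :
    excess x (N + 1) = letterSign (x 0) * (t.length + (h % 2 : ℕ)) ∧
      letterSign (x N) = if Odd h then letterSign (x 0) else - letterSign (x 0) := by
  induction N generalizing h t with
  | zero =>
    obtain ⟨rfl, rfl⟩ : 1 = h ∧ [] = t := by simpa [cutList] using e
    simp [excess]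
  | succ N ih =>
    obtain ⟨h', t', e', -⟩ := exists_cutList_eq_cons x N
    rw [cutList_succ_of_eq_cons e'] at e
    have h1 := hx N (by omega)
    have h2 := hx (N + 1) (by omega)
    rw [excess_succ]
    split_ifs at e with hne
    · obtain ⟨rfl, rfl⟩ := List.cons.inj e
      obtain ⟨ih1, ih2⟩ := ih (fun i hi => hx i (by omega)) e' ht
      have h3 : letterSign (x (N + 1)) = - letterSign (x N) := by
        unfold letterSign
        omega
      rw [ih1, h3, ih2]
      rcases Nat.even_or_odd h' with hp | hp
      · have hp' : ¬ Odd h' := Nat.not_odd_iff_even.2 hp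
        have hq : Odd (h' + 1) := hp.add_one
        rw [if_neg hp', if_pos hq, Nat.even_iff.1 hp, Nat.odd_iff.1 hq]
        push_cast
        exact ⟨by ring, by ring⟩
      · have hq : Even (h' + 1) := hp.add_one
        have hq' : ¬ Odd (h' + 1) := Nat.not_odd_iff_even.2 hq
        rw [if_pos hp, if_neg hq', Nat.even_iff.1 hq, Nat.odd_iff.1 hp]
        push_cast
        exact ⟨by ring, by ring⟩
    · obtain ⟨rfl, rfl⟩ := List.cons.inj e
      have ho := ht h' (by simp)
      obtain ⟨ih1, ih2⟩ := ih (fun i hi => hx i (by omega)) e' fun k hk => ht k (by simp [hk])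
      have h3 : x (N + 1) = x N := by omega
      rw [ih1, h3, ih2, if_pos ho, Nat.odd_iff.1 ho]
      simp
      ring

theorem exists_even_mem_cutList {x : ℕ → ℕ} (N : ℕ) (hx : ∀ i < N + 1, x i = 1 ∨ x i = 2)
    (hb : excess x (N + 1) = 0) : ∃ k ∈ cutList x (N + 1), Even k := by
  by_contra! hc
  obtain ⟨h, t, e, -⟩ := exists_cutList_eq_cons x N
  have ho : ∀ k ∈ h :: t, Odd k := fun k hk => Nat.not_even_iff_odd.1 (hc k (e ▸ hk))
  have h1 := (excess_of_odd_cuts N hx e fun k hk => ho k (by simp [hk])).1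
  rw [hb, Nat.odd_iff.1 (ho h (by simp))] at h1
  rcases hx 0 (by omega) with h0 | h0 <;> rw [h0] at h1 <;> simp [letterSign] at h1 <;> omega

/-! ### Minimizing the cost of a list of cut lengths -/

/-- `⌊k² / 4⌋` lies above its tangents `d k - d²`. -/
theorem tangent_le_sq_div_four (d k : ℤ) : d * k - d ^ 2 ≤ k ^ 2 / 4 := by
  have : (d * k - d ^ 2) * 4 ≤ k ^ 2 := by nlinarith [sq_nonneg (k - 2 * d)]
  omega

theorem sq_div_four_eq_tangent {d k : ℤ} (h : |k - 2 * d| ≤ 1) : k ^ 2 / 4 = d * k - d ^ 2 := by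
  have h1 : (k - 2 * d) ^ 2 ≤ 1 := by
    rw [← sq_abs]
    nlinarith [abs_nonneg (k - 2 * d)]
  have : k ^ 2 = (d * k - d ^ 2) * 4 + (k - 2 * d) ^ 2 := by ring
  have := sq_nonneg (k - 2 * d)
  omega

/-- The line with slope `d + 1/2` that touches `⌊k² / 4⌋` at `k = 2 d + 1`, the mean of the
tangents with slopes `d` and `d + 1`, meets it at no even `k`. -/
theorem midTangent_lt_sq_div_four {d k : ℤ} (hk : Even k) :
    (2 * d + 1) * k - (2 * d ^ 2 + 2 * d + 1) + 1 ≤ 2 * (k ^ 2 / 4) := by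
  obtain ⟨a, rfl⟩ := hk
  have h : (a + a) ^ 2 / 4 = a ^ 2 := by
    have : (a + a) ^ 2 = 4 * a ^ 2 := by ring
    omega
  rw [h]
  have : 0 ≤ (a - d) * (a - (d + 1)) := by
    rcases le_or_gt a d with h1 | h1
    · nlinarith
    · nlinarith
  nlinarith

/-- The sum of `⌊k² / 4⌋` over the entries of a list. -/
def quarterSquares (L : List ℤ) : ℤ := (L.map fun k => k ^ 2 / 4).sum

theorem quarterSquares_cons (k : ℤ) (L : List ℤ) :
    quarterSquares (k :: L) = k ^ 2 / 4 + quarterSquares L := by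
  simp [quarterSquares]

theorem quarterSquares_append (L M : List ℤ) :
    quarterSquares (L ++ M) = quarterSquares L + quarterSquares M := by
  simp [quarterSquares]

theorem quarterSquares_replicate (c : ℕ) (k : ℤ) :
    quarterSquares (List.replicate c k) = c * (k ^ 2 / 4) := by
  simp [quarterSquares]

theorem tangent_le_quarterSquares (d : ℤ) (L : List ℤ) :
    d * L.sum - L.length * d ^ 2 ≤ quarterSquares L := by
  induction L with
  | nil => simp [quarterSquares]
  | cons k L ih =>
    have := tangent_le_sq_div_four d k
    rw [quarterSquares_cons, List.sum_cons, List.length_cons]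
    push_cast
    linarith

theorem midTangent_le_quarterSquares (d : ℤ) (L : List ℤ) :
    (2 * d + 1) * L.sum - L.length * (2 * d ^ 2 + 2 * d + 1) ≤ 2 * quarterSquares L := by
  have h1 := tangent_le_quarterSquares d L
  have h2 := tangent_le_quarterSquares (d + 1) L
  linarith

theorem midTangent_lt_quarterSquares (d : ℤ) (L : List ℤ) (hL : ∃ k ∈ L, Even k) :
    (2 * d + 1) * L.sum - L.length * (2 * d ^ 2 + 2 * d + 1) + 1 ≤ 2 * quarterSquares L := by
  obtain ⟨k, hk, he⟩ := hL
  obtain ⟨L₁, L₂, rfl⟩ := List.append_of_mem hk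
  have h1 := midTangent_le_quarterSquares d L₁
  have h2 := midTangent_le_quarterSquares d L₂
  have h3 := midTangent_lt_sq_div_four (d := d) he
  rw [quarterSquares_append, quarterSquares_cons, List.sum_append, List.sum_cons,
    List.length_append, List.length_cons]
  push_cast
  linarith

theorem quarterSquares_eq_tangent {d : ℤ} {L : List ℤ} (h : ∀ k ∈ L, |k - 2 * d| ≤ 1) :
    quarterSquares L = d * L.sum - L.length * d ^ 2 := by
  induction L with
  | nil => simp [quarterSquares]
  | cons k L ih =>
    have h1 := sq_div_four_eq_tangent (h k (by simp))
    have h2 := ih fun k hk => h k (by simp [hk])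
    rw [quarterSquares_cons, List.sum_cons, List.length_cons, h1, h2]
    push_cast
    ring

theorem psiTuple_eq (L : List ℤ) : psiTuple L = quarterSquares L - L.sum + L.length := by
  induction L with
  | nil => simp [psiTuple, quarterSquares]
  | cons k L ih =>
    have h : psi k = k ^ 2 / 4 - k + 1 := by
      have : (k - 2) ^ 2 = k ^ 2 + 4 * (1 - k) := by ring
      unfold psi
      omega
    have h' : psiTuple (k :: L) = psi k + psiTuple L := by simp [psiTuple]
    rw [h', h, ih, quarterSquares_cons, List.sum_cons, List.length_cons]
    push_cast
    ring

theorem two_le_of_even_of_odd_div {n c : ℕ} (hc : 0 < c) (hn : Even n)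
    (h : Odd (n / c) ∧ n % c = 0) : 2 ≤ c := by
  by_contra hc'
  obtain rfl : c = 1 := by omega
  rw [Nat.div_one] at h
  exact (Nat.not_even_iff_odd.2 h.1) hn

theorem cutLengths_length {n c : ℕ} (hc : 0 < c) (hn : Even n) :
    (cutLengths n c).length = c := by
  unfold cutLengths
  split_ifs with h
  · have := two_le_of_even_of_odd_div hc hn h
    simp
    omega
  · have := Nat.mod_lt n hc
    simp
    omega

theorem cutLengths_sum {n c : ℕ} (hc : 0 < c) (hn : Even n) : (cutLengths n c).sum = n := by
  have hd : ((c : ℤ) * (n / c : ℕ) + (n % c : ℕ)) = n := by exact_mod_cast Nat.div_add_mod n c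
  unfold cutLengths
  split_ifs with h
  · have h2 := two_le_of_even_of_odd_div hc hn h
    rw [h.2] at hd
    simp only [List.sum_cons, List.sum_append, List.sum_replicate, List.sum_nil, nsmul_eq_mul]
    rw [Nat.cast_sub h2, ← hd]
    push_cast
    ring
  · have h2 := (Nat.mod_lt n hc).le
    simp only [List.sum_append, List.sum_replicate, nsmul_eq_mul]
    rw [Nat.cast_sub h2]
    conv_rhs => rw [← hd]
    ring

theorem exists_even_mem_cutLengths {n c : ℕ} (hc : 0 < c) :
    ∃ k ∈ cutLengths n c, Even k := by
  have h2 := Nat.mod_lt n hc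
  unfold cutLengths
  split_ifs with h
  · refine ⟨_, List.mem_cons_self, ?_⟩
    exact_mod_cast h.1.add_one
  · rcases Nat.even_or_odd (n / c) with hq | hq
    · refine ⟨(n / c : ℕ), ?_, by exact_mod_cast hq⟩
      exact List.mem_append.2 (Or.inr (List.mem_replicate.2 ⟨by omega, rfl⟩))
    · refine ⟨(n / c : ℕ) + 1, ?_, by exact_mod_cast hq.add_one⟩
      exact List.mem_append.2 (Or.inl (List.mem_replicate.2 ⟨fun h0 => h ⟨hq, h0⟩, rfl⟩))

theorem abs_le_one_of_mem_cutLengths {n c s : ℕ} (h1 : 2 * s * c ≤ n)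
    (h2 : n < (2 * s + 1) * c) {k : ℤ} (hk : k ∈ cutLengths n c) : |k - 2 * (s : ℤ)| ≤ 1 := by
  have hq : n / c = 2 * s := by
    rw [Nat.div_eq_of_lt_le] <;> assumption
  unfold cutLengths at hk
  have hne : ¬ (Odd (n / c) ∧ n % c = 0) := by
    rintro ⟨h, -⟩
    rw [hq] at h
    exact (Nat.not_odd_iff_even.2 (even_two_mul s)) h
  rw [if_neg hne, hq] at hk
  simp only [List.mem_append, List.mem_replicate] at hk
  rcases hk with ⟨-, rfl⟩ | ⟨-, rfl⟩ <;> simp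

theorem abs_le_one_of_mem_cutLengths' {n c s : ℕ} (hc : 0 < c) (h1 : (2 * s + 1) * c < n)
    (h2 : n ≤ (2 * s + 2) * c) {k : ℤ} (hk : k ∈ cutLengths n c) :
    |k - 2 * ((s + 1 : ℕ) : ℤ)| ≤ 1 := by
  rcases h2.lt_or_eq with h2 | h2
  · have hq : n / c = 2 * s + 1 := by
      rw [Nat.div_eq_of_lt_le]
      · exact h1.le
      · exact h2
    have hr : n % c ≠ 0 := by
      intro h0
      have := Nat.div_add_mod n c
      rw [hq, h0, mul_comm] at this
      omega
    unfold cutLengths at hk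
    rw [if_neg fun h => hr h.2, hq] at hk
    simp only [List.mem_append, List.mem_replicate] at hk
    rcases hk with ⟨-, rfl⟩ | ⟨-, rfl⟩ <;> push_cast <;> ring_nf <;> simp
  · apply abs_le_one_of_mem_cutLengths _ _ hk
    · rw [h2]; exact le_of_eq (by ring)
    · rw [h2]; nlinarith

theorem quarterSquares_cutLengths_of_eq {n c s : ℕ} (hc : 2 ≤ c) (h : n = (2 * s + 1) * c) :
    quarterSquares (cutLengths n c) = c * ((s : ℤ) ^ 2 + s) + 1 := by
  have hq : n / c = 2 * s + 1 := by rw [h, Nat.mul_div_cancel _ (by omega)]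
  have hr : n % c = 0 := by rw [h, Nat.mul_mod_left]
  unfold cutLengths
  rw [if_pos ⟨hq ▸ odd_two_mul_add_one s, hr⟩, hq, quarterSquares_cons, quarterSquares_append,
    quarterSquares_replicate, quarterSquares_cons,
    sq_div_four_eq_tangent (d := s + 1), sq_div_four_eq_tangent (d := s),
    sq_div_four_eq_tangent (d := s), Nat.cast_sub hc]
  · simp only [quarterSquares, List.map_nil, List.sum_nil]
    push_cast
    ring
  · push_cast; ring_nf; simp
  · push_cast; ring_nf; simp
  · push_cast; ring_nf; simp

/-- The number of cuts of an optimal word: the integer nearest to `√r`. -/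
def optimalCuts (r : ℕ) : ℕ :=
  if r ≤ Nat.sqrt r ^ 2 + Nat.sqrt r then Nat.sqrt r else Nat.sqrt r + 1

theorem optimalCuts_pos {r : ℕ} (hr : 0 < r) : 0 < optimalCuts r := by
  have := Nat.sqrt_pos.2 hr
  unfold optimalCuts
  split_ifs <;> omega

/-- Among the lists of cut lengths with an even entry, the cost `c r + ∑ ⌊k² / 4⌋` is smallest at
the nearly equal parts with `c` the integer nearest to `√r`. The cost, as a function of `c`, is
bounded below by its values on the tangents at slopes `s` and `s + 1`, where `s = ⌊√r⌋`; the first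
of these bounds is nondecreasing in `c` and the second one decreases. -/
theorem cost_cutLengths_optimalCuts_le {r : ℕ} (hr : 0 < r) {L : List ℤ}
    (hs : L.sum = 2 * r) (he : ∃ k ∈ L, Even k) :
    (optimalCuts r : ℤ) * r + quarterSquares (cutLengths (2 * r) (optimalCuts r)) ≤
      L.length * r + quarterSquares L := by
  have hc0 := optimalCuts_pos hr
  have hspos := Nat.sqrt_pos.2 hr
  have hs1 : Nat.sqrt r ^ 2 ≤ r := Nat.sqrt_le' r
  have hs2 : r < (Nat.sqrt r + 1) ^ 2 := Nat.lt_succ_sqrt' r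
  have hlen : (cutLengths (2 * r) (optimalCuts r)).length = optimalCuts r :=
    cutLengths_length hc0 (even_two_mul r)
  have hsum : (cutLengths (2 * r) (optimalCuts r)).sum = (2 * r : ℕ) :=
    cutLengths_sum hc0 (even_two_mul r)
  have b0 := tangent_le_quarterSquares (Nat.sqrt r : ℤ) L
  have b1 := tangent_le_quarterSquares (Nat.sqrt r + 1 : ℤ) L
  have b2 := midTangent_lt_quarterSquares (Nat.sqrt r : ℤ) L he
  rw [hs] at b0 b1 b2
  have hc : optimalCuts r = if r ≤ Nat.sqrt r ^ 2 + Nat.sqrt r then Nat.sqrt r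
    else Nat.sqrt r + 1 := rfl
  generalize Nat.sqrt r = s at *
  generalize optimalCuts r = c₀ at *
  generalize hQ : quarterSquares L = Q at *
  generalize hl : L.length = c at *
  have hlow : 2 * s * c₀ ≤ 2 * r := by
    split_ifs at hc <;> subst hc <;> nlinarith
  have hhigh : 2 * r ≤ (2 * s + 2) * c₀ := by
    split_ifs at hc <;> subst hc <;> nlinarith
  have hcase : (r ≤ s ^ 2 + s ∧ c₀ = s) ∨ (s ^ 2 + s < r ∧ c₀ = s + 1) := by
    split_ifs at hc with h
    · exact Or.inl ⟨h, hc⟩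
    · exact Or.inr ⟨by omega, hc⟩
  -- the three cases: the mean length of a cut is below, equal to, or above `2 s + 1`
  rcases lt_trichotomy (2 * r) ((2 * s + 1) * c₀) with h | h | h
  · rw [quarterSquares_eq_tangent fun k hk => abs_le_one_of_mem_cutLengths hlow h hk, hsum, hlen]
    clear hhigh hlow hc hlen hsum
    zify at *
    generalize (c₀ : ℤ) = k₀ at *
    rcases hcase with ⟨hr', rfl⟩ | ⟨hr', rfl⟩
    · rcases le_or_gt (s : ℤ) c with h' | h'
      · nlinarith [mul_nonneg (sub_nonneg.2 h') (sub_nonneg.2 hs1)]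
      · nlinarith [mul_nonneg (sub_nonneg.2 (Int.le_sub_one_of_lt h')) (sub_nonneg.2 hs2.le)]
    · rcases le_or_gt (s + 1 : ℤ) c with h' | h'
      · nlinarith [mul_nonneg (sub_nonneg.2 h') (sub_nonneg.2 hs1)]
      · nlinarith [mul_nonneg (sub_nonneg.2 (Int.le_of_lt_add_one h')) (sub_nonneg.2 hs2.le)]
  · have hc2 : 2 ≤ c₀ := by
      by_contra hlt
      obtain rfl : c₀ = 1 := by omega
      omega
    rw [quarterSquares_cutLengths_of_eq hc2 h]
    clear hhigh hlow hc hlen hsum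
    zify at *
    generalize (c₀ : ℤ) = k₀ at *
    have hs1' : (s : ℤ) ^ 2 + 1 ≤ r := by
      rcases hcase with ⟨hr', rfl⟩ | ⟨hr', rfl⟩ <;> nlinarith
    rcases lt_trichotomy (c : ℤ) k₀ with h' | h' | h'
    · have := mul_nonneg (sub_nonneg.2 (Int.le_sub_one_of_lt h'))
        (sub_nonneg.2 (Int.add_one_le_of_lt hs2))
      rcases hcase with ⟨hr', rfl⟩ | ⟨hr', rfl⟩ <;> nlinarith
    · rw [h'] at b2 ⊢
      nlinarith
    · have := mul_nonneg (sub_nonneg.2 (Int.add_one_le_of_lt h')) (sub_nonneg.2 hs1')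
      rcases hcase with ⟨hr', rfl⟩ | ⟨hr', rfl⟩ <;> nlinarith
  · rw [quarterSquares_eq_tangent
      fun k hk => abs_le_one_of_mem_cutLengths' hc0 h hhigh hk, hsum, hlen]
    clear hhigh hlow hc hlen hsum
    zify at *
    generalize (c₀ : ℤ) = k₀ at *
    rcases hcase with ⟨hr', rfl⟩ | ⟨hr', rfl⟩
    · rcases le_or_gt (s + 1 : ℤ) c with h' | h'
      · nlinarith [mul_nonneg (sub_nonneg.2 h') (sub_nonneg.2 hs1)]
      · nlinarith [mul_nonneg (sub_nonneg.2 (Int.le_of_lt_add_one h')) (sub_nonneg.2 hs2.le)]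
    · rcases le_or_gt (s + 2 : ℤ) c with h' | h'
      · nlinarith [mul_nonneg (sub_nonneg.2 h') (sub_nonneg.2 hs1)]
      · have h' : (c : ℤ) ≤ s + 1 := by omega
        nlinarith [mul_nonneg (sub_nonneg.2 h') (sub_nonneg.2 hs2.le)]

/-! ### Words with prescribed cut lengths -/

/-- There is a word of ones and twos with cut lengths `L` in some order, with excess `e` of ones
over twos, and with last letter `b` (any letter, for the empty word). -/
def Realizable (L : List ℕ) (e : ℤ) (b : ℕ) : Prop :=
  (b = 1 ∨ b = 2) ∧ ∃ x : ℕ → ℕ, (∀ i < L.sum, x i = 1 ∨ x i = 2) ∧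
    (cutList x L.sum).Perm L ∧ excess x L.sum = e ∧ (L.sum = 0 ∨ x (L.sum - 1) = b)

theorem Realizable.perm {L M : List ℕ} {e : ℤ} {b : ℕ} (h : Realizable L e b) (hp : L.Perm M) :
    Realizable M e b := by
  obtain ⟨hb, x, h1, h2, h3⟩ := h
  rw [hp.sum_eq] at h1 h2 h3
  exact ⟨hb, x, h1, h2.trans hp, h3⟩

/-- The sequence `x` continued from position `n` on by the alternating sequence that starts with
the letter `b`. -/
def appendAlternating (n b : ℕ) (x : ℕ → ℕ) : ℕ → ℕ :=
  fun i => if i < n then x i else if Even (i - n) then b else 3 - b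

theorem appendAlternating_add (n b : ℕ) (x : ℕ → ℕ) (j : ℕ) :
    appendAlternating n b x (n + j) = if Even j then b else 3 - b := by
  simp [appendAlternating]

theorem appendAlternating_of_lt {n i : ℕ} (b : ℕ) (x : ℕ → ℕ) (h : i < n) :
    appendAlternating n b x i = x i := by
  simp [appendAlternating, h]

theorem cutList_appendAlternating {n b : ℕ} {x : ℕ → ℕ} (hb : b = 1 ∨ b = 2)
    (h : n = 0 ∨ x (n - 1) = b) (k : ℕ) :
    cutList (appendAlternating n b x) (n + k + 1) = (k + 1) :: cutList x n := by
  have h0 : cutList (appendAlternating n b x) n = cutList x n :=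
    cutList_congr n fun i hi => appendAlternating_of_lt b x hi
  induction k with
  | zero =>
    cases n with
    | zero => rfl
    | succ n =>
      obtain ⟨a, t, e, -⟩ := exists_cutList_eq_cons x n
      have h1 : appendAlternating (n + 1) b x n = b := by
        rw [appendAlternating_of_lt b x (by omega)]
        simpa using h
      have h2 : appendAlternating (n + 1) b x (n + 1) = b := by
        simpa using appendAlternating_add (n + 1) b x 0
      rw [e] at h0 ⊢
      rw [add_zero, cutList_succ_of_eq_cons h0, h1, h2]
      simp
  | succ k ih =>
    have h1 := appendAlternating_add n b x k
    have h2 := appendAlternating_add n b x (k + 1)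
    rw [← add_assoc, cutList_succ_of_eq_cons ih, if_pos]
    rw [← add_assoc] at h2
    rw [h1, h2]
    simp only [Nat.even_add_one]
    rcases hb with rfl | rfl <;> split_ifs <;> omega

theorem excess_appendAlternating {n b : ℕ} (x : ℕ → ℕ) (hb : b = 1 ∨ b = 2) (k : ℕ) :
    excess (appendAlternating n b x) (n + k) =
      excess x n + if Odd k then letterSign b else 0 := by
  induction k with
  | zero =>
    simp only [add_zero, Nat.not_odd_zero, if_false]
    exact Finset.sum_congr rfl fun i hi => by
      rw [appendAlternating_of_lt b x (Finset.mem_range.1 hi)]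
  | succ k ih =>
    rw [← add_assoc, excess_succ, ih, appendAlternating_add]
    rcases Nat.even_or_odd k with hk | hk
    · have h1 : ¬ Odd k := Nat.not_odd_iff_even.2 hk
      have h2 : Odd (k + 1) := hk.add_one
      simp [h1, h2, hk]
    · have h1 : ¬ Even k := Nat.not_even_iff_odd.2 hk
      have h2 : ¬ Odd (k + 1) := Nat.not_odd_iff_even.2 hk.add_one
      rcases hb with rfl | rfl <;> simp [h1, h2, hk, letterSign]

theorem Realizable.cons {L : List ℕ} {e : ℤ} {b : ℕ} (h : Realizable L e b) {k : ℕ}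
    (hk : 0 < k) :
    Realizable (k :: L) (e + if Odd k then letterSign b else 0) (if Odd k then b else 3 - b) := by
  obtain ⟨hb, x, h1, h2, rfl, h4⟩ := h
  obtain ⟨k, rfl⟩ : ∃ j, k = j + 1 := ⟨k - 1, by omega⟩
  have hs : (((k + 1) :: L).sum) = L.sum + k + 1 := by rw [List.sum_cons]; omega
  refine ⟨by split_ifs <;> omega, appendAlternating L.sum b x, ?_, ?_, ?_, ?_⟩
  · intro i _
    by_cases hi : i < L.sum
    · rw [appendAlternating_of_lt b x hi]
      exact h1 i hi
    · obtain ⟨j, rfl⟩ := Nat.exists_eq_add_of_le (not_lt.1 hi)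
      rw [appendAlternating_add]
      split_ifs <;> omega
  · rw [hs, cutList_appendAlternating hb h4]
    exact h2.cons _
  · rw [hs, add_assoc, excess_appendAlternating x hb]
  · right
    rw [hs, Nat.add_sub_cancel, appendAlternating_add]
    simp only [Nat.odd_add_one, Nat.not_odd_iff_even]

theorem realizable_nil : Realizable [] 0 1 :=
  ⟨Or.inl rfl, fun _ => 1, by simp, by simp [cutList], by simp [excess], by simp⟩

theorem Realizable.append_odd {L : List ℕ} {e : ℤ} {b : ℕ} (h : Realizable L e b) (O : List ℕ)
    (hO : ∀ k ∈ O, Odd k) : Realizable (O ++ L) (e + O.length * letterSign b) b := by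
  induction O with
  | nil => simpa using h
  | cons k O ih =>
    have hk := hO k (by simp)
    have := (ih fun k hk => hO k (by simp [hk])).cons hk.pos
    rw [if_pos hk, if_pos hk] at this
    have hc : e + ((k :: O).length : ℤ) * letterSign b =
        e + O.length * letterSign b + letterSign b := by
      rw [List.length_cons]
      push_cast
      ring
    rw [hc]
    exact this

theorem Realizable.append_even {L : List ℕ} {e : ℤ} {b : ℕ} (h : Realizable L e b) (E : List ℕ)
    (hE : ∀ k ∈ E, Even k ∧ 0 < k) : ∃ b', Realizable (E ++ L) e b' := by
  induction E with
  | nil => exact ⟨b, h⟩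
  | cons k E ih =>
    have hk := hE k (by simp)
    obtain ⟨b', hb'⟩ := ih fun k hk => hE k (by simp [hk])
    have := hb'.cons hk.2
    rw [if_neg (Nat.not_odd_iff_even.2 hk.1), add_zero] at this
    exact ⟨_, this⟩

theorem even_length_of_odd_of_even_sum (O : List ℕ) (hO : ∀ k ∈ O, Odd k) :
    Even O.sum ↔ Even O.length := by
  induction O with
  | nil => simp
  | cons k O ih =>
    have hk := hO k (by simp)
    rw [List.sum_cons, List.length_cons, Nat.even_add_one, Nat.even_add,
      ih fun k hk => hO k (by simp [hk])]
    have := Nat.not_even_iff_odd.2 hk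
    tauto

/-- A balanced word with prescribed cut lengths: one half of the odd cuts, an even cut, which
reverses the sign that the odd cuts contribute, the other half of the odd cuts, and the remaining
even cuts. -/
theorem exists_balanced_realizable {L : List ℕ} (hpos : ∀ k ∈ L, 0 < k) (hs : Even L.sum)
    (he : ∃ k ∈ L, Even k) : ∃ b, Realizable L 0 b := by
  set O := L.filter (fun k => !decide (Even k)) with hO
  set E := L.filter (fun k => decide (Even k)) with hE
  have hp : (E ++ O).Perm L := List.filter_append_perm (fun k => decide (Even k)) L
  have hOo : ∀ k ∈ O, Odd k := by
    intro k hk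
    simpa using (List.mem_filter.1 hk).2
  have hEe : ∀ k ∈ E, Even k ∧ 0 < k := by
    intro k hk
    have := List.mem_filter.1 hk
    exact ⟨by simpa using this.2, hpos k this.1⟩
  obtain ⟨k, hk, hke⟩ := he
  have hkE : k ∈ E := List.mem_filter.2 ⟨hk, by simpa using hke⟩
  obtain ⟨E₁, E₂, hE12⟩ := List.append_of_mem hkE
  have hEs : Even E.sum := by
    have : ∀ M : List ℕ, (∀ k ∈ M, Even k) → Even M.sum := by
      intro M hM
      induction M with
      | nil => simp
      | cons a M ih =>
        rw [List.sum_cons]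
        exact (hM a (by simp)).add (ih fun k hk => hM k (by simp [hk]))
    exact this E fun k hk => (hEe k hk).1
  have hOl : Even O.length := by
    rw [← even_length_of_odd_of_even_sum O hOo]
    have := hp.sum_eq
    rw [List.sum_append] at this
    rw [← this, Nat.even_add] at hs
    exact hs.1 hEs
  obtain ⟨j, hj⟩ := hOl
  have r1 := realizable_nil.append_odd (O.take j) fun k hk => hOo k (List.mem_of_mem_take hk)
  have r2 := r1.cons (hEe k hkE).2
  rw [if_neg (Nat.not_odd_iff_even.2 hke), if_neg (Nat.not_odd_iff_even.2 hke)] at r2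
  have r3 := r2.append_odd (O.drop j) fun k hk => hOo k (List.mem_of_mem_drop hk)
  obtain ⟨b, r4⟩ := r3.append_even (E₁ ++ E₂) fun k hk => hEe k (by
    rw [hE12]
    rcases List.mem_append.1 hk with h | h <;> simp [h])
  refine ⟨b, ?_⟩
  have hz : (0 : ℤ) + (O.take j).length * letterSign 1 + 0 + (O.drop j).length * letterSign (3 - 1)
      = 0 := by
    rw [List.length_take, List.length_drop, hj, Nat.min_eq_left (by omega), Nat.add_sub_cancel]
    simp [letterSign]
  rw [hz] at r4
  refine r4.perm (List.Perm.trans ?_ hp)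
  rw [hE12, ← Multiset.coe_eq_coe]
  conv_rhs => rw [← List.take_append_drop j O]
  simp only [← Multiset.coe_add, ← Multiset.cons_coe, Multiset.coe_nil, add_zero,
    ← Multiset.singleton_add]
  abel

/-! ### Multipermutations as balanced words -/

theorem excess_zeroExtend {n : ℕ} (m : Fin n → ℕ) :
    excess (zeroExtend m) n = ∑ i, letterSign (m i) := by
  unfold excess
  rw [Finset.sum_range]
  exact Finset.sum_congr rfl fun i _ => by rw [zeroExtend_val]

theorem multiperm_eq_one_or_two {r : ℕ} (σ : Equiv.Perm (Fin (2 * r))) (i : Fin (2 * r)) :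
    multiperm r σ i = 1 ∨ multiperm r σ i = 2 := by
  have h := (σ i).isLt
  have : (σ i : ℕ) / r < 2 := Nat.div_lt_of_lt_mul (by omega)
  unfold multiperm
  generalize (σ i : ℕ) / r = d at *
  omega

theorem sum_letterSign_multiperm {r : ℕ} (hr : 0 < r) (σ : Equiv.Perm (Fin (2 * r))) :
    ∑ i, letterSign (multiperm r σ i) = 0 := by
  have h := Equiv.sum_comp σ fun i : Fin (2 * r) => letterSign ((i : ℕ) / r + 1)
  unfold multiperm
  rw [h, Fin.sum_univ_eq_sum_range (fun i => letterSign (i / r + 1)), two_mul,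
    Finset.sum_range_add]
  have h1 : ∀ i ∈ Finset.range r, letterSign (i / r + 1) = 1 := by
    intro i hi
    rw [Nat.div_eq_of_lt (Finset.mem_range.1 hi)]
    rfl
  have h2 : ∀ i ∈ Finset.range r, letterSign ((r + i) / r + 1) = -1 := by
    intro i hi
    rw [Nat.add_div_left _ hr, Nat.div_eq_of_lt (Finset.mem_range.1 hi)]
    rfl
  rw [Finset.sum_congr rfl h1, Finset.sum_congr rfl h2]
  simp

theorem two_mul_card_ones {n : ℕ} {m : Fin n → ℕ} (h : ∀ i, m i = 1 ∨ m i = 2)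
    (hs : ∑ i, letterSign (m i) = 0) : 2 * Fintype.card {i // m i = 1} = n := by
  have h1 : ∀ i, letterSign (m i) = 2 * (if m i = 1 then 1 else 0) - 1 := by
    intro i
    rcases h i with h | h <;> simp [h, letterSign]
  simp only [h1, Finset.sum_sub_distrib, ← Finset.mul_sum, Finset.sum_boole] at hs
  rw [Fintype.card_subtype]
  simp at hs
  omega

/-- The multipermutations are the balanced words of ones and twos. -/
theorem mem_multiperms_iff {r : ℕ} (hr : 0 < r) (m : Fin (2 * r) → ℕ) :
    m ∈ multiperms (2 * r) r ↔
      (∀ i, m i = 1 ∨ m i = 2) ∧ excess (zeroExtend m) (2 * r) = 0 := by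
  rw [excess_zeroExtend]
  constructor
  · rintro ⟨σ, rfl⟩
    exact ⟨multiperm_eq_one_or_two σ, sum_letterSign_multiperm hr σ⟩
  · rintro ⟨h1, h2⟩
    have c1 := two_mul_card_ones h1 h2
    have c2 := two_mul_card_ones (multiperm_eq_one_or_two (1 : Equiv.Perm (Fin (2 * r))))
      (sum_letterSign_multiperm hr 1)
    have e : {i // m i = 1} ≃ {i // multiperm r (1 : Equiv.Perm (Fin (2 * r))) i = 1} :=
      Fintype.equivOfCardEq (by omega)
    refine ⟨e.extendSubtype, funext fun i => ?_⟩
    change multiperm r (1 : Equiv.Perm (Fin (2 * r))) (e.extendSubtype i) = m i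
    by_cases hi : m i = 1
    · rw [hi]
      exact e.extendSubtype_mem i hi
    · have h3 := e.extendSubtype_not_mem i hi
      have h4 := multiperm_eq_one_or_two (1 : Equiv.Perm (Fin (2 * r))) (e.extendSubtype i)
      have := h1 i
      omega

theorem zeroExtend_eq_one_or_two {n : ℕ} {m : Fin n → ℕ} (h : ∀ i, m i = 1 ∨ m i = 2) :
    ∀ i < n, zeroExtend m i = 1 ∨ zeroExtend m i = 2 := by
  intro i hi
  rw [show zeroExtend m i = m ⟨i, hi⟩ from zeroExtend_val m ⟨i, hi⟩]
  exact h _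

/-! ### The size of the sphere -/

/-- The lengths of the cuts of the tuple `m`, as integers. -/
def cutLengthsOf {n : ℕ} (m : Fin n → ℕ) : List ℤ :=
  (cutList (zeroExtend m) n).map fun k : ℕ => (k : ℤ)

theorem cutLengthsOf_sum {n : ℕ} (m : Fin n → ℕ) : (cutLengthsOf m).sum = n := by
  have := cutList_sum (zeroExtend m) n
  unfold cutLengthsOf
  rw [← Nat.cast_list_sum, this]

/-- The size of the sphere depends only on the cut lengths: each of the `n + 1 - c` runs of equal
letters accounts for `r` neighbours, and a cut of length `k` for `⌊k² / 4⌋` coincidences. -/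
theorem ncard_ulamSphere_one_eq {r : ℕ} (hr : 0 < r) {m : Fin (2 * r) → ℕ}
    (hm : m ∈ multiperms (2 * r) r) :
    ((ulamSphere r m 1).ncard : ℤ) =
      1 + (2 * r + 1) * r - ((cutLengthsOf m).length * r + quarterSquares (cutLengthsOf m)) := by
  obtain ⟨h1, h2⟩ := (mem_multiperms_iff hr m).1 hm
  have hx := zeroExtend_eq_one_or_two h1
  rw [ncard_ulamSphere_one (by omega) hm]
  have e1 := ncard_translocations (by omega) hx
  have e2 := card_altPairs (2 * r) (zeroExtend m) hx
  have e3 : quarterSquares (cutLengthsOf m) =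
      (((cutList (zeroExtend m) (2 * r)).map fun k => k ^ 2 / 4).sum : ℕ) := by
    unfold quarterSquares cutLengthsOf
    rw [Nat.cast_list_sum, List.map_map, List.map_map]
    congr 1
  have e6 : (cutLengthsOf m).length = (cutList (zeroExtend m) (2 * r)).length := by
    simp [cutLengthsOf]
  obtain ⟨N, hN⟩ : ∃ N, 2 * r = N + 1 := ⟨2 * r - 1, by omega⟩
  have e4 : (leftMoves (2 * r) (zeroExtend m)).card + (rightMoves (2 * r) (zeroExtend m)).card =
      numChanges (zeroExtend m) N * r + r := by
    have := card_leftMoves_add_card_rightMoves (x := zeroExtend m) hN.symm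
      (fun i hi => hx i (by omega)) (by rw [← hN]; exact h2)
    rwa [← hN] at this
  have e5 : (cutList (zeroExtend m) (2 * r)).length + numChanges (zeroExtend m) N = 2 * r := by
    have := cutList_length (zeroExtend m) N
    rwa [← hN] at this
  rw [e3, e6, ← e2]
  have e7 : ((cutList (zeroExtend m) (2 * r)).length : ℤ) =
      2 * r - numChanges (zeroExtend m) N := by
    have : (((cutList (zeroExtend m) (2 * r)).length + numChanges (zeroExtend m) N : ℕ) : ℤ) =
      (2 * r : ℕ) := by rw [e5]
    push_cast at this
    linarith
  rw [e7]
  zify at e1 e4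
  linarith

theorem exists_even_mem_cutLengthsOf {r : ℕ} (hr : 0 < r) {m : Fin (2 * r) → ℕ}
    (hm : m ∈ multiperms (2 * r) r) : ∃ k ∈ cutLengthsOf m, Even k := by
  obtain ⟨h1, h2⟩ := (mem_multiperms_iff hr m).1 hm
  have hx := zeroExtend_eq_one_or_two h1
  obtain ⟨N, hN⟩ : ∃ N, 2 * r = N + 1 := ⟨2 * r - 1, by omega⟩
  obtain ⟨k, hk, he⟩ := exists_even_mem_cutList N (x := zeroExtend m)
    (fun i hi => hx i (by omega)) (by rw [← hN]; exact h2)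
  rw [← hN] at hk
  exact ⟨k, List.mem_map.2 ⟨k, hk, rfl⟩, by exact_mod_cast he⟩

theorem optimalCuts_le {r : ℕ} (hr : 0 < r) : optimalCuts r ≤ r := by
  have hspos := Nat.sqrt_pos.2 hr
  have hs1 : Nat.sqrt r ^ 2 ≤ r := Nat.sqrt_le' r
  unfold optimalCuts
  split_ifs <;> nlinarith

theorem pos_of_mem_cutLengths {n c : ℕ} (hc : 0 < c) (h : 2 * c ≤ n) {k : ℤ}
    (hk : k ∈ cutLengths n c) : 0 < k := by
  have hq : 2 ≤ n / c := (Nat.le_div_iff_mul_le hc).2 h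
  unfold cutLengths at hk
  split_ifs at hk
  · simp only [List.mem_cons, List.mem_append, List.mem_replicate, List.not_mem_nil,
      or_false] at hk
    omega
  · simp only [List.mem_append, List.mem_replicate] at hk
    omega

/-! ### Attaining the optimal cut lengths -/

/-- The nearly equal cut lengths are those of a multipermutation. -/
theorem exists_multiperm_cutLengthsOf_perm {r c : ℕ} (hr : 0 < r) (hc : 0 < c) (h : c ≤ r) :
    ∃ m ∈ multiperms (2 * r) r, (cutLengthsOf m).Perm (cutLengths (2 * r) c) := by
  set L := (cutLengths (2 * r) c).map Int.toNat with hL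
  have hcast : L.map (fun k : ℕ => (k : ℤ)) = cutLengths (2 * r) c := by
    rw [hL, List.map_map]
    conv_rhs => rw [← List.map_id (cutLengths (2 * r) c)]
    apply List.map_congr_left
    intro k hk
    have := pos_of_mem_cutLengths hc (by omega) hk
    simp
    omega
  have hsum : L.sum = 2 * r := by
    have h1 := cutLengths_sum hc (even_two_mul r)
    rw [← hcast, ← Nat.cast_list_sum] at h1
    exact_mod_cast h1
  obtain ⟨b, -, x, h1, h2, h3, -⟩ := exists_balanced_realizable (L := L)
    (by
      intro k hk
      have : (k : ℤ) ∈ cutLengths (2 * r) c := hcast ▸ List.mem_map.2 ⟨k, hk, rfl⟩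
      exact_mod_cast pos_of_mem_cutLengths hc (by omega) this)
    (hsum ▸ even_two_mul r)
    (by
      obtain ⟨k, hk, he⟩ := exists_even_mem_cutLengths (n := 2 * r) hc
      rw [← hcast] at hk
      obtain ⟨j, hj, rfl⟩ := List.mem_map.1 hk
      exact ⟨j, hj, by exact_mod_cast he⟩)
  rw [hsum] at h1 h2 h3
  set m : Fin (2 * r) → ℕ := fun i => x i with hm
  have hmx : ∀ i < 2 * r, zeroExtend m i = x i := by
    intro i hi
    simp [zeroExtend, hi, hm]
  refine ⟨m, (mem_multiperms_iff hr m).2 ⟨fun i => h1 i i.isLt, ?_⟩, ?_⟩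
  · rw [← h3]
    exact Finset.sum_congr rfl fun i hi => by rw [hmx i (Finset.mem_range.1 hi)]
  · rw [← hcast, cutLengthsOf, cutList_congr _ hmx]
    exact h2.map _

/-! ### The number of cuts -/

theorem isAlternating_iff {n : ℕ} {m : Fin n → ℕ} (h : ∀ i, m i = 1 ∨ m i = 2) (a b : Fin n) :
    IsAlternating m a b ↔ Alternates (zeroExtend m) a b := by
  constructor
  · rintro ⟨h1, -⟩ i hi hib
    have hb := b.isLt
    rw [show zeroExtend m i = m ⟨i, by omega⟩ from zeroExtend_val m ⟨i, by omega⟩,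
      show zeroExtend m (i + 1) = m ⟨i + 1, by omega⟩ from zeroExtend_val m ⟨i + 1, by omega⟩]
    exact h1 _ _ hi (Fin.mk_le_of_le_val hib) rfl
  · intro h1
    have h2 : ∀ i j : Fin n, a ≤ i → j ≤ b → (j : ℕ) = i + 1 → m i ≠ m j := by
      intro i j hi hj hij
      rw [← zeroExtend_val m i, ← zeroExtend_val m j, hij]
      have : (j : ℕ) ≤ b := hj
      exact h1 i hi (by omega)
    refine ⟨h2, fun i j hi hj hij => ?_⟩
    have hj' : (j : ℕ) ≤ b := hj
    have hi' : (a : ℕ) ≤ i := hi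
    have hjn := j.isLt
    have e1 := h2 i ⟨i + 1, by omega⟩ hi (Fin.mk_le_of_le_val (by omega)) rfl
    have e2 := h2 ⟨i + 1, by omega⟩ j (Fin.le_def.2 (by simp; omega)) hj (by simp; omega)
    have := h i
    have := h j
    have := h ⟨i + 1, by omega⟩
    omega

/-- A cut is determined by its first position, which is `0` or repeats the letter before it. -/
theorem numCuts_eq_card {N : ℕ} {m : Fin (N + 1) → ℕ} (h : ∀ i, m i = 1 ∨ m i = 2) :
    numCuts m = ((Finset.range (N + 1)).filter fun p =>
      p = 0 ∨ zeroExtend m (p - 1) = zeroExtend m p).card := by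
  set x := zeroExtend m
  set C := {p : Fin (N + 1) × Fin (N + 1) | IsCut m p.1 p.2} with hC
  have hinj : Set.InjOn (fun p : Fin (N + 1) × Fin (N + 1) => (p.1 : ℕ)) C := by
    have key : ∀ a b b', IsCut m a b → IsCut m a b' → ¬ b < b' := by
      intro a b b' h1 h2 hlt
      have hlt' : (b : ℕ) < b' := hlt
      have hb' := b'.isLt
      have ha : (a : ℕ) ≤ b := h1.1
      apply h1.2.2.2 ⟨b + 1, by omega⟩ rfl
      have h3 := (isAlternating_iff h _ _).1 h2.2.1
      exact (isAlternating_iff h _ _).2 fun i hi hib => h3 i hi (by simp at hib; omega)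
    rintro ⟨a, b⟩ h1 ⟨a', b'⟩ h2 e
    obtain rfl : a = a' := Fin.ext e
    rcases lt_trichotomy b b' with hlt | rfl | hlt
    · exact absurd hlt (key a b b' h1 h2)
    · rfl
    · exact absurd hlt (key a b' b h2 h1)
  unfold numCuts
  rw [← hC, ← hinj.ncard_image, ← Set.ncard_coe_finset]
  congr 1
  ext p
  simp only [Set.mem_image, Finset.coe_filter, Finset.mem_range, Set.mem_ofPred_eq]
  constructor
  · rintro ⟨⟨a, b⟩, hcut, rfl⟩
    refine ⟨a.isLt, ?_⟩
    by_contra! hc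
    obtain ⟨h0, hne⟩ := hc
    have ha := a.isLt
    have hab : (a : ℕ) ≤ b := hcut.1
    simp only at h0 hne
    apply hcut.2.2.1 ⟨a - 1, by omega⟩ (by simp; omega)
    have h3 := (isAlternating_iff h _ _).1 hcut.2.1
    refine (isAlternating_iff h _ _).2 fun i hi hib => ?_
    simp only at hi hib
    by_cases hia : (a : ℕ) ≤ i
    · exact h3 i hia hib
    · obtain rfl : i = a - 1 := by omega
      rw [Nat.sub_add_cancel (by omega)]
      exact hne
  · rintro ⟨hp, h0⟩
    classical
    -- the cut that starts at `p` ends at the last `b` such that `x` alternates on `[p, b]`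
    have hne : (Finset.univ.filter fun b : Fin (N + 1) => p ≤ b ∧ Alternates x p b).Nonempty :=
      ⟨⟨p, hp⟩, by simp [alternates_self]⟩
    obtain ⟨b, hb, hmax⟩ := Finset.exists_max_image _ (fun b => b) hne
    obtain ⟨hpb, halt⟩ := (Finset.mem_filter.1 hb).2
    refine ⟨(⟨p, hp⟩, b), ⟨hpb, (isAlternating_iff h _ _).2 halt, ?_, ?_⟩, rfl⟩
    · intro a' ha' hc
      have ha' : p = a' + 1 := ha'
      have hc : IsAlternating m a' b := hc
      rcases h0 with h0 | h0
      · omega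
      · apply (isAlternating_iff h _ _).1 hc a' le_rfl (by omega)
        rw [← ha']
        change x a' = x p
        rw [← h0, ha', Nat.add_sub_cancel]
    · intro b' hb' hc
      have hb' : (b' : ℕ) = b + 1 := hb'
      have h3 : b' ≤ b := hmax b' (Finset.mem_filter.2
        ⟨Finset.mem_univ _, by omega, (isAlternating_iff h _ _).1 hc⟩)
      have h4 : (b' : ℕ) ≤ b := h3
      omega

/-- The first positions of the cuts and the changes of letter are complementary. -/
theorem card_starts_add_numChanges (x : ℕ → ℕ) (N : ℕ) :
    ((Finset.range (N + 1)).filter fun p => p = 0 ∨ x (p - 1) = x p).card + numChanges x N =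
      N + 1 := by
  have h := Finset.card_filter_add_card_filter_not (s := Finset.range (N + 1))
    (fun p => p = 0 ∨ x (p - 1) = x p)
  rw [Finset.card_range] at h
  conv_rhs => rw [← h]
  congr 1
  rw [Finset.card_filter, Finset.sum_range_succ']
  simp [numChanges]

theorem numCuts_eq {r : ℕ} (hr : 0 < r) {m : Fin (2 * r) → ℕ}
    (hm : m ∈ multiperms (2 * r) r) : numCuts m = (cutLengthsOf m).length := by
  have h1 := ((mem_multiperms_iff hr m).1 hm).1
  clear hm
  have key : ∀ n (m : Fin n → ℕ), 0 < n → (∀ i, m i = 1 ∨ m i = 2) →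
      numCuts m = (cutLengthsOf m).length := by
    rintro (_ | N) m hn h1
    · omega
    · have e1 := cutList_length (zeroExtend m) N
      have e2 := card_starts_add_numChanges (zeroExtend m) N
      rw [numCuts_eq_card h1, cutLengthsOf, List.length_map]
      omega
  exact key _ m (by omega) h1

/-! ### The largest sphere -/

theorem optimalCuts_eq_floor_or_ceil (r : ℕ) :
    optimalCuts r = ⌊Real.sqrt r⌋₊ ∨ optimalCuts r = ⌈Real.sqrt r⌉₊ := by
  have hs2 : r < (Nat.sqrt r + 1) ^ 2 := Nat.lt_succ_sqrt' r
  unfold optimalCuts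
  split_ifs with h
  · left
    exact (Real.nat_floor_real_sqrt_eq_nat_sqrt).symm
  · right
    symm
    rw [Nat.ceil_eq_iff (by omega), Nat.add_sub_cancel]
    constructor
    · apply Real.lt_sqrt_of_sq_lt
      exact_mod_cast (by omega : Nat.sqrt r ^ 2 < r)
    · apply Real.sqrt_le_iff.2 ⟨by positivity, ?_⟩
      exact_mod_cast hs2.le

theorem mainTheorem11 (n r : ℕ) (hr : 0 < r) (hn : n = 2 * r) :
    IsGreatest ((fun m : Fin n → ℕ => ((ulamSphere r m 1).ncard : ℤ)) '' multiperms n r)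
      (1 + ((n : ℤ) - 1) ^ 2 -
        (({⌊Real.sqrt r⌋₊, ⌈Real.sqrt r⌉₊} : Finset ℕ).inf' (Finset.insert_nonempty _ _)
          (fun c : ℕ => (c : ℤ) * ((r : ℤ) - 1) + ((n : ℤ) - 1) * ((r : ℤ) - 1)
            + psiTuple (cutLengths n c)))) ∧
    ∃ m ∈ multiperms n r,
      (numCuts m = ⌊Real.sqrt r⌋₊ ∨ numCuts m = ⌈Real.sqrt r⌉₊) ∧
      ∀ m' ∈ multiperms n r, (ulamSphere r m' 1).ncard ≤ (ulamSphere r m 1).ncard := by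
  subst hn
  have hc₀ := optimalCuts_pos hr
  have hmem := optimalCuts_eq_floor_or_ceil r
  have hval : ∀ c : ℕ, 0 < c → (c : ℤ) * ((r : ℤ) - 1) + (((2 * r : ℕ) : ℤ) - 1) * ((r : ℤ) - 1)
      + psiTuple (cutLengths (2 * r) c) =
      (c : ℤ) * r + quarterSquares (cutLengths (2 * r) c) + (2 * (r : ℤ) ^ 2 - 5 * r + 1) := by
    intro c hc
    rw [psiTuple_eq, cutLengths_sum hc (even_two_mul r), cutLengths_length hc (even_two_mul r)]
    push_cast
    ring
  -- the minimum over the two admissible numbers of cuts is attained at `optimalCuts r`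
  have hinf : (({⌊Real.sqrt r⌋₊, ⌈Real.sqrt r⌉₊} : Finset ℕ).inf' (Finset.insert_nonempty _ _)
      (fun c : ℕ => (c : ℤ) * ((r : ℤ) - 1) + (((2 * r : ℕ) : ℤ) - 1) * ((r : ℤ) - 1)
        + psiTuple (cutLengths (2 * r) c))) =
      (optimalCuts r : ℤ) * r + quarterSquares (cutLengths (2 * r) (optimalCuts r)) +
        (2 * (r : ℤ) ^ 2 - 5 * r + 1) := by
    apply le_antisymm
    · rw [← hval _ hc₀]
      exact Finset.inf'_le _ (by simpa using hmem)
    · apply Finset.le_inf'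
      intro c hc
      have hc0 : 0 < c := by
        have h1 : (1 : ℝ) ≤ Real.sqrt r := Real.one_le_sqrt.2 (by exact_mod_cast hr)
        rcases Finset.mem_insert.1 hc with rfl | hc
        · exact Nat.floor_pos.2 h1
        · rw [Finset.mem_singleton.1 hc]
          exact Nat.ceil_pos.2 (by linarith)
      rw [hval c hc0]
      have := cost_cutLengths_optimalCuts_le hr (L := cutLengths (2 * r) c)
        (by rw [cutLengths_sum hc0 (even_two_mul r)]; push_cast; ring)
        (exists_even_mem_cutLengths hc0)
      rw [cutLengths_length hc0 (even_two_mul r)] at this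
      linarith
  -- the word that realizes the optimal cut lengths is a word with the largest sphere
  obtain ⟨m, hm, hp⟩ := exists_multiperm_cutLengthsOf_perm hr hc₀ (optimalCuts_le hr)
  have hlen : (cutLengthsOf m).length = optimalCuts r := by
    rw [hp.length_eq, cutLengths_length hc₀ (even_two_mul r)]
  have hq : quarterSquares (cutLengthsOf m) =
      quarterSquares (cutLengths (2 * r) (optimalCuts r)) := (hp.map _).sum_eq
  have hmax : ∀ m' ∈ multiperms (2 * r) r,
      ((ulamSphere r m' 1).ncard : ℤ) ≤ (ulamSphere r m 1).ncard := by
    intro m' hm'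
    rw [ncard_ulamSphere_one_eq hr hm', ncard_ulamSphere_one_eq hr hm, hlen, hq]
    have := cost_cutLengths_optimalCuts_le hr (L := cutLengthsOf m')
      (by rw [cutLengthsOf_sum]; push_cast; ring) (exists_even_mem_cutLengthsOf hr hm')
    linarith
  rw [hinf]
  refine ⟨⟨⟨m, hm, ?_⟩, ?_⟩, m, hm, ?_, fun m' hm' => by exact_mod_cast hmax m' hm'⟩
  · simp only
    rw [ncard_ulamSphere_one_eq hr hm, hlen, hq]
    push_cast
    ring
  · rintro _ ⟨m', hm', rfl⟩
    refine (hmax m' hm').trans (le_of_eq ?_)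
    rw [ncard_ulamSphere_one_eq hr hm, hlen, hq]
    push_cast
    ring
  · rw [numCuts_eq hr hm, hlen]
    exact hmem
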